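/- Let $p$ be an odd prime, let $k=\overline{\mathbb{F}}_p$ be an algebraic closure of $\mathbb{F}_p$, let $h\ge 1$, and let $R(X)=\sum_{i=0}^{h}a_iX^{p^i}\in k[X]$ with $a_h\neq 0$ be an additive polynomial of degree $p^h$. Let $C_R$ be the smooth projective curve over $k$ with affine equation $Y^p-Y=XR(X)$ and with function field $k(x,y)$, $y^p-y=xR(x)$. Put $$E(X)=R(X)^{p^h}+\sum_{i=0}^{h}(a_iX)^{p^{h-i}},\qquad W=\{c\in k: E(c)=0\},$$ so that $W$ is an $\mathbb{F}_p$-subspace of $k$. The curve $C_R$ has exactly one point $\infty$ that does not lie on the affine curve. Let $\operatorname{Aut}^0(C_R)$ be the group of those $k$-automorphisms of $C_R$ that fix $\infty$, and let $\rho$ be the automorphism $(x,y)\mapsto(x,y+1)$. Then $\operatorname{Aut}^0(C_R)$ has exactly one Sylow $p$-subgroup $P$, and $P$ is an extraspecial group of exponent $p$; that is, $P$ is a finite noncommutative $p$-group of exponent $p$ whose center $Z(P)$ has order $p$ and whose quotient $P/Z(P)$ is elementary abelian. Moreover $Z(P)=\langle\rho\rangle$, and there is a group isomorphism $P/Z(P)\cong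 W$ under which the class of $\sigma\in P$ corresponds to the element $c\in W$ with $\sigma^*x=x+c$. -/

import Mathlib

open Polynomial
open scoped Pointwise

noncomputable section

namespace ArtinSchreier

/-- A noncommutative finite `p`-group is extraspecial if its center has order `p` and the quotient
by its center is elementary abelian (abelian, and killed by `p`). -/
structure IsExtraspecial (p : ℕ) (G : Type*) [Group G] : Prop where
  finite : Finite G
  isPGroup : IsPGroup p G
  noncomm : ∃ a b : G, a * b ≠ b * a
  card_center : Nat.card (Subgroup.center G) = p
  quot_comm : ∀ a b : G ⧸ Subgroup.center G, a * b = b * a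
  quot_pow : ∀ a : G ⧸ Subgroup.center G, a ^ p = 1

/-- The algebraic closure of the prime field with `p` elements. -/
abbrev K (p : ℕ) [Fact p.Prime] : Type := AlgebraicClosure (ZMod p)

/-- The additive polynomials of degree `p ^ h` over the algebraic closure of the prime field,
given by their coefficients `a 0, …, a h`, where `a h ≠ 0`. -/
structure AddPoly (p : ℕ) [Fact p.Prime] (h : ℕ) where
  a : Fin (h + 1) → K p
  leading_ne_zero : a (Fin.last h) ≠ 0

variable {p : ℕ} [Fact p.Prime] {h : ℕ}

namespace AddPoly

/-- The polynomial `R(X) = ∑ i, a i * X ^ (p ^ i)`. -/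
def R (r : AddPoly p h) : (K p)[X] := ∑ i : Fin (h + 1), C (r.a i) * X ^ p ^ (i : ℕ)

/-- The polynomial `E(X) = R(X) ^ (p ^ h) + ∑ i, (a i * X) ^ (p ^ (h - i))`. -/
def E (r : AddPoly p h) : (K p)[X] :=
  r.R ^ p ^ h + ∑ i : Fin (h + 1), (C (r.a i) * X) ^ p ^ (h - (i : ℕ))

theorem eval_R (r : AddPoly p h) (c : K p) :
    r.R.eval c = ∑ i : Fin (h + 1), r.a i * c ^ p ^ (i : ℕ) := by
  simp [R, eval_finsetSum]

theorem eval_E (r : AddPoly p h) (c : K p) : r.E.eval c =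
    r.R.eval c ^ p ^ h + ∑ i : Fin (h + 1), (r.a i * c) ^ p ^ (h - (i : ℕ)) := by
  simp [E, eval_finsetSum]

theorem eval_E_add (r : AddPoly p h) (c d : K p) :
    r.E.eval (c + d) = r.E.eval c + r.E.eval d := by
  simp only [eval_E, eval_R, mul_add, add_pow_char_pow, Finset.sum_add_distrib]
  ring

theorem eval_E_zero (r : AddPoly p h) : r.E.eval 0 = 0 := by
  simpa using r.eval_E_add 0 0

/-- The zero locus `W` of `E`, as a vector space over the prime field. -/
def W (r : AddPoly p h) : Submodule (ZMod p) (K p) :=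
  AddSubgroup.toZModSubmodule p
    { carrier := {c | r.E.eval c = 0}
      add_mem' := fun {c d} hc hd => by
        simp only [Set.mem_ofPred_eq] at hc hd ⊢
        rw [eval_E_add, hc, hd, add_zero]
      zero_mem' := r.eval_E_zero
      neg_mem' := fun {c} hc => by
        simp only [Set.mem_ofPred_eq] at hc ⊢
        have := r.eval_E_add c (-c)
        rwa [add_neg_cancel, eval_E_zero, hc, zero_add, eq_comm] at this }

theorem mem_W (r : AddPoly p h) (c : K p) : c ∈ r.W ↔ r.E.eval c = 0 := Iff.rfl

end AddPoly

/-- If `T ^ p - T = f` has no solution in a field of characteristic `p`, then the polynomial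
`T ^ p - T - f` is irreducible. -/
theorem irreducible_of_no_root {L : Type*} [Field L] [CharP L p] (f : L)
    (hf : ∀ b : L, b ^ p - b ≠ f) : Irreducible (X ^ p - X - C f : L[X]) := by
  have hp1 : 1 < p := (Fact.out : p.Prime).one_lt
  have hg : (X ^ p - X - C f : L[X]) = X ^ p - (X + C f) := by ring
  have hdeg : (X + C f : L[X]).natDegree < p := by
    rw [natDegree_X_add_C]; exact hp1
  have hdeg' : (X + C f : L[X]).degree < (p : ℕ) := by
    rw [degree_X_add_C]; exact_mod_cast hp1
  have hmon : (X ^ p - X - C f : L[X]).Monic := by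
    rw [hg]; exact monic_X_pow_sub hdeg'
  have hnat : (X ^ p - X - C f : L[X]).natDegree = p := by
    rw [hg, natDegree_sub_eq_left_of_natDegree_lt] <;> simp [hp1]
  let M := AlgebraicClosure L
  have : CharP M p := charP_of_injective_algebraMap (FaithfulSMul.algebraMap_injective L M) p
  obtain ⟨α, hα⟩ := IsAlgClosed.exists_aeval_eq_zero M (X ^ p - X - C f : L[X]) (by
    rw [degree_eq_natDegree hmon.ne_zero, hnat]; exact_mod_cast (by omega : p ≠ 0))
  have hint : IsIntegral L α := ⟨_, hmon, hα⟩
  have hdvd : minpoly L α ∣ (X ^ p - X - C f : L[X]) := minpoly.dvd L α hα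
  have root_pow : ∀ β : M, aeval β (X ^ p - X - C f : L[X]) = 0 → β ^ p - β = algebraMap L M f := by
    intro β hβ
    simpa [sub_eq_zero] using hβ
  have hle : (minpoly L α).natDegree ≤ p := by
    simpa [hnat] using natDegree_le_of_dvd hdvd hmon.ne_zero
  have hge : p ≤ (minpoly L α).natDegree := by
    by_contra hlt
    push Not at hlt
    have hpos : 0 < (minpoly L α).natDegree := minpoly.natDegree_pos hint
    have hroots : ∀ β ∈ ((minpoly L α).map (algebraMap L M)).roots,
        ∃ c : L, β = α + algebraMap L M c := by
      intro β hβ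
      have hb0 : aeval β (minpoly L α) = 0 := by
        have := isRoot_of_mem_roots hβ
        rwa [IsRoot.def, eval_map_algebraMap] at this
      have hb : aeval β (X ^ p - X - C f : L[X]) = 0 := aeval_eq_zero_of_dvd_aeval_eq_zero hdvd hb0
      have h1 := root_pow β hb
      have h2 := root_pow α hα
      have h3 : (β - α) ^ p = β - α := by
        rw [sub_pow_char]
        linear_combination h1 - h2
      have h4 : β - α ∈ (⊥ : Subfield M) := (Subfield.mem_bot_iff_pow_eq_self M p).2 h3
      have h5 : β - α ∈ (algebraMap L M).fieldRange := (bot_le : (⊥ : Subfield M) ≤ _) h4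
      obtain ⟨c, hc⟩ := h5
      exact ⟨c, by rw [hc]; ring⟩
    have hsum : ∀ s : Multiset M, (∀ β ∈ s, ∃ c : L, β = α + algebraMap L M c) →
        ∃ c : L, s.sum = s.card * α + algebraMap L M c := by
      intro s
      induction s using Multiset.induction_on with
      | empty => intro _; exact ⟨0, by simp⟩
      | cons b s ih =>
        intro hs
        obtain ⟨c, hc⟩ := ih fun β hβ => hs β (Multiset.mem_cons_of_mem hβ)
        obtain ⟨d, hd⟩ := hs b (Multiset.mem_cons_self b s)
        refine ⟨d + c, ?_⟩
        rw [Multiset.sum_cons, Multiset.card_cons, hc, hd]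
        rw [(algebraMap L M).map_add, Nat.cast_add, Nat.cast_one]
        ring
    obtain ⟨c, hc⟩ := hsum _ hroots
    have hspl := IsAlgClosed.splits ((minpoly L α).map (algebraMap L M))
    have hnext := hspl.nextCoeff_eq_neg_sum_roots_of_monic ((minpoly.monic hint).map _)
    rw [nextCoeff_map (algebraMap L M).injective, hc, ← hspl.natDegree_eq_card_roots,
      natDegree_map] at hnext
    have hd0 : ((minpoly L α).natDegree : L) ≠ 0 := by
      intro h0
      rw [CharP.cast_eq_zero_iff L p] at h0
      exact absurd (Nat.le_of_dvd hpos h0) (by omega)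
    have hd0' : ((minpoly L α).natDegree : M) ≠ 0 := by
      rw [← map_natCast (algebraMap L M)]
      exact (_root_.map_ne_zero _).2 hd0
    apply hf (-((minpoly L α).nextCoeff + c) / (minpoly L α).natDegree)
    apply (algebraMap L M).injective
    have hα' : algebraMap L M (-((minpoly L α).nextCoeff + c) / (minpoly L α).natDegree) = α := by
      rw [map_div₀, map_neg, map_add, hnext, map_natCast, div_eq_iff hd0']
      ring
    rw [map_sub, map_pow, hα']
    exact root_pow α hα
  have heq : minpoly L α = (X ^ p - X - C f : L[X]) :=
    (eq_of_monic_of_dvd_of_natDegree_le (minpoly.monic hint) hmon hdvd (by rw [hnat]; exact hge)).symm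
  rw [← heq]
  exact minpoly.irreducible hint

namespace AddPoly

/-- The polynomial `Y ^ p - Y - X * R(X)` in the variable `Y` over the field `k(X)`. -/
def equation (r : AddPoly p h) : (RatFunc (K p))[X] :=
  X ^ p - X - C (algebraMap (K p)[X] (RatFunc (K p)) (X * r.R))

theorem eval₂_equation (r : AddPoly p h) {T : Type*} [CommRing T] (i : RatFunc (K p) →+* T) (z : T) :
    r.equation.eval₂ i z =
      z ^ p - z - i (algebraMap (K p)[X] (RatFunc (K p)) (X * r.R)) := by
  simp only [equation, eval₂_sub, eval₂_pow, eval₂_X, eval₂_C]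

theorem natDegree_R (r : AddPoly p h) : r.R.natDegree = p ^ h := by
  have hp1 : 1 < p := (Fact.out : p.Prime).one_lt
  unfold R
  rw [Fin.sum_univ_castSucc, natDegree_add_eq_right_of_degree_lt]
  · simpa using natDegree_C_mul_X_pow (p ^ h) _ r.leading_ne_zero
  · rw [Fin.val_last, degree_C_mul_X_pow _ r.leading_ne_zero]
    refine (degree_sum_le _ _).trans_lt ?_
    rw [Finset.sup_lt_iff (WithBot.bot_lt_coe _)]
    intro i _
    refine (degree_C_mul_X_pow_le _ _).trans_lt ?_
    exact_mod_cast Nat.pow_lt_pow_right hp1 i.isLt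

theorem R_ne_zero (r : AddPoly p h) : r.R ≠ 0 := by
  intro h0
  have := r.natDegree_R
  rw [h0, natDegree_zero] at this
  exact (pow_pos (Fact.out : p.Prime).pos h).ne this

instance irreducible_equation [Fact (p ≠ 2)] (r : AddPoly p h) : Fact (Irreducible r.equation) := by
  refine ⟨irreducible_of_no_root _ fun b hb => ?_⟩
  have hp : p.Prime := Fact.out
  have hp1 : 1 < p := hp.one_lt
  obtain ⟨g, rfl⟩ : ∃ g : (K p)[X], algebraMap _ (RatFunc (K p)) g = b := by
    have hm : (X ^ p - (X + C (X * r.R)) : (K p)[X][X]).Monic :=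
      monic_X_pow_sub (by rw [degree_X_add_C]; exact_mod_cast hp1)
    obtain ⟨g, hg⟩ := isInteger_of_is_root_of_monic (K := RatFunc (K p)) hm (r := b) (by
      simp only [map_sub, map_add, map_pow, aeval_X, aeval_C]
      linear_combination hb)
    exact ⟨g, hg⟩
  rw [← map_pow, ← map_sub] at hb
  have hb := RatFunc.algebraMap_injective (K p) hb
  have hdeg := congrArg natDegree hb
  rw [natDegree_mul X_ne_zero r.R_ne_zero, natDegree_X, natDegree_R] at hdeg
  rcases Nat.eq_zero_or_pos g.natDegree with h0 | h0
  · rw [eq_C_of_natDegree_eq_zero h0, ← C_pow, ← C_sub, natDegree_C] at hdeg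
    omega
  · rw [natDegree_sub_eq_left_of_natDegree_lt, natDegree_pow] at hdeg
    · rcases Nat.eq_zero_or_pos h with rfl | hh
      · have h2 : p ∣ 2 := ⟨g.natDegree, by rw [hdeg, pow_zero, one_add_one_eq_two]⟩
        have h3 := (Nat.prime_dvd_prime_iff_eq hp Nat.prime_two).1 h2
        exact (Fact.out : p ≠ 2) h3
      · have h1 : p ∣ 1 := by
          have ha : p ∣ 1 + p ^ h := ⟨_, hdeg.symm⟩
          exact (Nat.dvd_add_left (dvd_pow_self p hh.ne')).1 ha
        exact hp.one_lt.ne' (Nat.dvd_one.1 h1)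
    · rw [natDegree_pow]
      nlinarith

variable [Fact (p ≠ 2)]

/-- The function field `k(x, y)`, `y ^ p - y = x * R(x)`, of the curve `C_R`. -/
abbrev FunctionField (r : AddPoly p h) : Type := AdjoinRoot r.equation

/-- The coordinate function `x` on the curve. -/
def x (r : AddPoly p h) : r.FunctionField := AdjoinRoot.of r.equation RatFunc.X

/-- The coordinate function `y` on the curve. -/
def y (r : AddPoly p h) : r.FunctionField := AdjoinRoot.root r.equation

theorem aeval_x (r : AddPoly p h) (g : (K p)[X]) :
    aeval r.x g = AdjoinRoot.of r.equation (algebraMap (K p)[X] (RatFunc (K p)) g) := by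
  have h1 : (AdjoinRoot.of r.equation).comp (algebraMap (K p)[X] (RatFunc (K p))) =
      (aeval r.x : (K p)[X] →ₐ[K p] r.FunctionField).toRingHom := by
    ext c
    · simp [AdjoinRoot.algebraMap_eq', RatFunc.algebraMap_eq_C]
    · simp [x]
  exact (DFunLike.congr_fun h1 g).symm

theorem y_equation (r : AddPoly p h) : r.y ^ p - r.y = r.x * aeval r.x r.R := by
  have h1 := AdjoinRoot.eval₂_root r.equation
  have h2 := r.aeval_x (X * r.R)
  rw [map_mul, aeval_X] at h2
  rw [h2]
  rw [eval₂_equation] at h1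
  exact sub_eq_zero.1 h1

/-- The automorphisms over `k` of the smooth projective curve `C_R`, given by the pullback of
functions, that is, as the automorphisms over `k` of its function field. -/
abbrev Aut (r : AddPoly p h) : Type := r.FunctionField ≃ₐ[K p] r.FunctionField

/-- The points of the smooth projective curve `C_R` are the places of its function field over `k`;
a point is represented by its local ring, a proper valuation subring that contains `k`. -/
def IsPoint (r : AddPoly p h) (v : ValuationSubring r.FunctionField) : Prop :=
  (∀ c : K p, algebraMap (K p) r.FunctionField c ∈ v) ∧ v ≠ ⊤

/-- The points at infinity: those that do not lie on the affine curve `y ^ p - y = x * R(x)`,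
that is, those at which the functions `x` and `y` are not both regular. -/
def IsInfinite (r : AddPoly p h) (v : ValuationSubring r.FunctionField) : Prop :=
  r.IsPoint v ∧ ¬ (r.x ∈ v ∧ r.y ∈ v)

/-- The group of automorphisms of the curve `C_R` over `k` that fix infinity. An automorphism
fixes a point if and only if the pullback of functions maps the local ring there to itself. -/
def Aut₀ (r : AddPoly p h) : Subgroup r.Aut :=
  ⨅ (v : ValuationSubring r.FunctionField) (_ : r.IsInfinite v), v.decompositionSubgroup (K p)

/-- For `c` in the prime field, the endomorphism of the function field with `x ↦ x` and
`y ↦ y + c`. -/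
def translateHom (r : AddPoly p h) (c : ZMod p) : r.FunctionField →ₐ[K p] r.FunctionField :=
  AdjoinRoot.liftAlgHom r.equation
    (IsScalarTower.toAlgHom (K p) (RatFunc (K p)) r.FunctionField)
    (r.y + algebraMap (K p) r.FunctionField (algebraMap (ZMod p) (K p) c)) (by
      have : CharP r.FunctionField p :=
        charP_of_injective_algebraMap (algebraMap (K p) r.FunctionField).injective p
      have h1 := AdjoinRoot.eval₂_root r.equation
      have h2 : (algebraMap (K p) r.FunctionField (algebraMap (ZMod p) (K p) c)) ^ p =
          algebraMap (K p) r.FunctionField (algebraMap (ZMod p) (K p) c) := by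
        rw [← map_pow, ← map_pow, ZMod.pow_card]
      change eval₂ (AdjoinRoot.of r.equation) _ r.equation = 0
      rw [eval₂_equation] at h1 ⊢
      rw [add_pow_char, h2, ← h1, y]
      ring)

theorem translateHom_x (r : AddPoly p h) (c : ZMod p) : r.translateHom c r.x = r.x := by
  rw [translateHom, x, AdjoinRoot.liftAlgHom_of]
  rfl

theorem translateHom_y (r : AddPoly p h) (c : ZMod p) : r.translateHom c r.y =
    r.y + algebraMap (K p) r.FunctionField (algebraMap (ZMod p) (K p) c) := by
  exact AdjoinRoot.liftAlgHom_root ..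

theorem algHom_ext' (r : AddPoly p h) {f g : r.FunctionField →ₐ[K p] r.FunctionField}
    (hx : f r.x = g r.x) (hy : f r.y = g r.y) : f = g := by
  have h1 : f.comp (IsScalarTower.toAlgHom (K p) (RatFunc (K p)) r.FunctionField) =
      g.comp (IsScalarTower.toAlgHom (K p) (RatFunc (K p)) r.FunctionField) := by
    apply AlgHom.coe_ringHom_injective
    apply IsLocalization.ringHom_ext (nonZeroDivisors (K p)[X])
    ext c
    · change f (algebraMap (K p) r.FunctionField c) = g (algebraMap (K p) r.FunctionField c)
      rw [f.commutes, g.commutes]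
    · change f (AdjoinRoot.of r.equation (algebraMap (K p)[X] (RatFunc (K p)) X)) =
        g (AdjoinRoot.of r.equation (algebraMap (K p)[X] (RatFunc (K p)) X))
      rw [RatFunc.algebraMap_X]
      exact hx
  apply AlgHom.coe_ringHom_injective
  apply AdjoinRoot.ringHom_ext
  · ext c
    exact DFunLike.congr_fun h1 c
  · exact hy

/-- The Artin–Schreier automorphism `ρ(x, y) = (x, y + 1)`. -/
def ρ (r : AddPoly p h) : r.Aut :=
  AlgEquiv.ofAlgHom (r.translateHom 1) (r.translateHom (-1))
    (r.algHom_ext' (by simp [translateHom_x]) (by simp [translateHom_y]))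
    (r.algHom_ext' (by simp [translateHom_x]) (by simp [translateHom_y]))

theorem ρ_x (r : AddPoly p h) : r.ρ r.x = r.x := r.translateHom_x 1

theorem ρ_y (r : AddPoly p h) : r.ρ r.y = r.y + 1 := by
  have h1 := r.translateHom_y 1
  rw [map_one, map_one] at h1
  exact h1

end AddPoly

end ArtinSchreier

end

/-!
Write `A = k[x, y]` and let `∞` be a place of the function field at which `x` is not regular.

**Infinity.** The discriminant of `Y ^ p - Y - x R(x)` over `k[x]` is a unit, so `A` is integrally
closed (`mem_adjoin_y_of_isIntegral`), and it consists of the functions that are regular at all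
points where `x` and `y` are regular (`mem_adjoin_y_of_forall_mem`). At `∞` the valuations of `x`
and `y` satisfy `v(y) ^ p = v(x) ^ (p ^ h + 1)`, and as `p ^ h + 1` is prime to `p`, distinct
monomials `x ^ i * y ^ j` with `j < p` have distinct valuations. So `v` is determined on `A` by
the numerical function `poleOrder` (`valuation_aeval_y_pow`), which proves that `∞` is unique.

**Automorphisms.** An automorphism `σ` that fixes `∞` preserves `A` and the ordering of its
elements by pole order. The function `x` has the least pole order among the nonconstant elements
of `A`, and `y` has the least pole order among those outside `k[x]`. Hence `σ x = a x + b` and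
`σ y = c y + Q(x)` with `c ^ p = c` (`Aut₀_apply_x`, `Aut₀_apply_y`). If `σ` has `p`-power order,
then `a = c = 1`, since `k` has no nontrivial `p`-power roots of unity. So each `p`-subgroup is
contained in the group `shiftSubgroup` of the automorphisms `(x, y) ↦ (x + c, y + Q(x))`.

**Shifts.** The pair `(c, Q)` defines an automorphism if and only if
`Q ^ p - Q = c R(X) + X R(c) + c R(c)`. Comparison of the coefficients of `X ^ (p ^ i)` gives a
recursion that determines `Q = B_c + b` up to its constant term, with `B_c = sol c` additive, and
that is solvable if and only if `E(c) = 0` (`mem_W_of_sol`, `sol_pow_sub`). Because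
`Q(X + d) - Q(X)` is the constant `B_c(d)`, the `p`-th power of a shift maps `y` to
`y + p Q(x) + (p choose 2) B_c(c) = y`; so `shiftSubgroup` has exponent `p` and is the only Sylow
`p`-subgroup (`coe_sylow_eq`).

**The center.** The map `(c, Q) ↦ c` onto `W` has kernel `⟨ρ⟩`. Two shifts by `c` and `d` commute
if and only if `B_c(d) = B_d(c)`. If this holds for all `d` in `W` and `c ≠ 0`, then
`B_d(c) - B_c(d)` is a polynomial in `d` of degree `p ^ (2 h - 1)` that vanishes on `W`, although
`W` has `p ^ (2 h)` elements, as `E` is separable (`eq_zero_of_eval_sol_comm`). So the center is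
the kernel `⟨ρ⟩`.
-/

noncomputable section

namespace ArtinSchreier

/-! ### The equation `Q ^ p - Q = c R(X) + X R(c) + e` -/

section

variable {p : ℕ} [Fact p.Prime] {h : ℕ}

namespace AddPoly

/-- The coefficient of `X ^ (p ^ i)` in `R`, with the value `0` for `i > h`. -/
def coeffN (r : AddPoly p h) (i : ℕ) : K p := if hi : i < h + 1 then r.a ⟨i, hi⟩ else 0

theorem R_eq_sum_range (r : AddPoly p h) :
    r.R = ∑ i ∈ Finset.range (h + 1), C (r.coeffN i) * X ^ p ^ i := by
  rw [Finset.sum_range, R]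
  exact Finset.sum_congr rfl fun i _ => by rw [coeffN, dif_pos i.isLt]

theorem E_eq_sum_range (r : AddPoly p h) :
    r.E = r.R ^ p ^ h + ∑ i ∈ Finset.range (h + 1), (C (r.coeffN i) * X) ^ p ^ (h - i) := by
  rw [Finset.sum_range, E]
  congr 1
  exact Finset.sum_congr rfl fun i _ => by rw [coeffN, dif_pos i.isLt]

theorem coeffN_self_ne_zero (r : AddPoly p h) : r.coeffN h ≠ 0 := by
  rw [coeffN, dif_pos h.lt_succ_self]
  exact r.leading_ne_zero

theorem eval_R_add (r : AddPoly p h) (c d : K p) :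
    r.R.eval (c + d) = r.R.eval c + r.R.eval d := by
  simp only [eval_R, mul_add, add_pow_char_pow, Finset.sum_add_distrib]

theorem coeff_pow_char {L : Type*} [CommRing L] [CharP L p] (Q : L[X]) (i : ℕ) :
    (Q ^ p).coeff (i * p) = Q.coeff i ^ p := by
  rw [← map_frobenius_expand p, coeff_map, coeff_expand_mul (Fact.out : p.Prime).pos,
    frobenius_def]

theorem coeff_pow_char_one {L : Type*} [CommRing L] [CharP L p] (Q : L[X]) :
    (Q ^ p).coeff 1 = 0 := by
  have hp : p.Prime := Fact.out
  rw [← map_frobenius_expand p, coeff_map, coeff_expand hp.pos,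
    if_neg (hp.one_lt.ne' ∘ Nat.dvd_one.1), map_zero]

theorem eq_C_of_pow_char_sub_eq_C {L : Type*} [Field L] {Q : L[X]} {e : L}
    (hQ : Q ^ p - Q = C e) : ∃ b, Q = C b := by
  have hp1 : 1 < p := (Fact.out : p.Prime).one_lt
  refine ⟨_, eq_C_of_natDegree_eq_zero ?_⟩
  by_contra h0
  have h1 : Q.natDegree < (Q ^ p).natDegree := by
    rw [natDegree_pow]
    nlinarith [Nat.pos_of_ne_zero h0]
  have h2 := congrArg natDegree hQ
  rw [natDegree_sub_eq_left_of_natDegree_lt h1, natDegree_C, natDegree_pow] at h2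
  simp at h2
  omega

/-- The coefficient of `X ^ (p ^ i)` in a solution `Q` of `Q ^ p - Q = c R(X) + X R(c) + c R(c)`,
as a polynomial in `c`. -/
def solCoeff (r : AddPoly p h) : ℕ → (K p)[X]
  | 0 => -(C (r.coeffN 0) * X) - r.R
  | i + 1 => r.solCoeff i ^ p - C (r.coeffN (i + 1)) * X

theorem solCoeff_eq (r : AddPoly p h) (i : ℕ) :
    r.solCoeff i = -(r.R ^ p ^ i + ∑ j ∈ Finset.range (i + 1),
      (C (r.coeffN j) * X) ^ p ^ (i - j)) := by
  induction i with
  | zero => simp [solCoeff]; ring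
  | succ i ih =>
    have h1 : (-1 : (K p)[X]) ^ p = -1 := by
      rw [neg_one_pow_char]
    rw [solCoeff, ih, neg_pow, h1, add_pow_char, Finset.sum_range_succ _ (i + 1), sum_pow_char,
      ← pow_mul, ← pow_succ]
    have : ∀ j ∈ Finset.range (i + 1), ((C (r.coeffN j) * X) ^ p ^ (i - j)) ^ p =
        (C (r.coeffN j) * X) ^ p ^ (i + 1 - j) := fun j hj => by
      rw [← pow_mul, ← pow_succ, Nat.succ_sub (by simpa [Nat.lt_succ_iff] using hj)]
    rw [Finset.sum_congr rfl this]
    simp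
    ring

theorem solCoeff_self (r : AddPoly p h) : r.solCoeff h = -r.E := by
  rw [solCoeff_eq, E_eq_sum_range]

theorem natDegree_solCoeff (r : AddPoly p h) (hh : 1 ≤ h) (i : ℕ) :
    (r.solCoeff i).natDegree = p ^ (h + i) := by
  have hp1 : 1 < p := (Fact.out : p.Prime).one_lt
  induction i with
  | zero =>
    rw [solCoeff, natDegree_sub_eq_right_of_natDegree_lt, natDegree_R, add_zero]
    rw [natDegree_neg, natDegree_R]
    exact ((natDegree_C_mul_le _ _).trans_eq natDegree_X).trans_lt (Nat.one_lt_pow (by omega) hp1)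
  | succ i ih =>
    rw [solCoeff, natDegree_sub_eq_left_of_natDegree_lt, natDegree_pow, ih]
    · ring
    · rw [natDegree_pow, ih]
      refine ((natDegree_C_mul_le _ _).trans_eq natDegree_X).trans_lt ?_
      rw [mul_comm, ← pow_succ]
      exact Nat.one_lt_pow (by omega) hp1

theorem natDegree_E (r : AddPoly p h) (hh : 1 ≤ h) : r.E.natDegree = p ^ (h + h) := by
  rw [← r.natDegree_solCoeff hh h, solCoeff_self, natDegree_neg]

theorem E_ne_zero (r : AddPoly p h) (hh : 1 ≤ h) : r.E ≠ 0 := by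
  intro h0
  have := r.natDegree_E hh
  rw [h0, natDegree_zero] at this
  exact (pow_pos (Fact.out : p.Prime).pos _).ne this

theorem derivative_E (r : AddPoly p h) (hh : 1 ≤ h) : derivative r.E = C (r.coeffN h) := by
  obtain ⟨k, rfl⟩ : ∃ k, h = k + 1 := ⟨h - 1, by omega⟩
  have h1 := r.solCoeff_self
  rw [← neg_eq_iff_eq_neg] at h1
  rw [← h1, solCoeff]
  simp [derivative_pow]

open Classical in
theorem card_roots_E (r : AddPoly p h) (hh : 1 ≤ h) :
    r.E.roots.toFinset.card = p ^ (h + h) := by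
  have hs : r.E.Separable := by
    rw [Polynomial.Separable, derivative_E r hh]
    exact (isCoprime_one_right.of_isCoprime_of_dvd_right
      ((isUnit_C.2 (Ne.isUnit r.coeffN_self_ne_zero)).dvd))
  rw [Multiset.toFinset_card_of_nodup (nodup_roots hs), ← r.natDegree_E hh]
  exact (IsAlgClosed.splits r.E).natDegree_eq_card_roots.symm

theorem finite_W (r : AddPoly p h) (hh : 1 ≤ h) : Finite r.W := by
  classical
  refine Finite.Set.subset (r.E.roots.toFinset : Set (K p)) fun c hc => ?_
  simpa [E_ne_zero r hh] using (r.mem_W c).1 hc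

/-- A polynomial that vanishes on `W` and has degree less than `p ^ (2 * h)` is zero. -/
theorem eq_zero_of_eval_W_eq_zero (r : AddPoly p h) (hh : 1 ≤ h) {H : (K p)[X]}
    (hdeg : H.natDegree < p ^ (h + h)) (hH : ∀ c ∈ r.W, H.eval c = 0) : H = 0 := by
  classical
  refine eq_zero_of_natDegree_lt_card_of_eval_eq_zero' H r.E.roots.toFinset (fun c hc => ?_) ?_
  · refine hH c ?_
    rw [mem_W]
    simpa [E_ne_zero r hh] using hc
  · rwa [card_roots_E r hh]

/-- The polynomial `B_c`: for `c` in `W`, the solution without constant term of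
`Q ^ p - Q = c R(X) + X R(c)`. -/
def sol (r : AddPoly p h) (c : K p) : (K p)[X] :=
  ∑ i ∈ Finset.range h, C ((r.solCoeff i).eval c) * X ^ p ^ i

theorem eval_sol_add (r : AddPoly p h) (c d e : K p) :
    (r.sol c).eval (d + e) = (r.sol c).eval d + (r.sol c).eval e := by
  simp [sol, eval_finsetSum, mul_add, add_pow_char_pow, Finset.sum_add_distrib]

/-- The recursion stops at any index `k` with the error term `solCoeff k`, evaluated at `c`; for
`k = h` this term is `-E(c)`. -/
theorem sum_solCoeff_pow_sub (r : AddPoly p h) (c : K p) (k : ℕ) :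
    (∑ i ∈ Finset.range k, C ((r.solCoeff i).eval c) * X ^ p ^ i) ^ p -
      ∑ i ∈ Finset.range k, C ((r.solCoeff i).eval c) * X ^ p ^ i =
      C c * ∑ i ∈ Finset.range (k + 1), C (r.coeffN i) * X ^ p ^ i + X * C (r.R.eval c)
        + C ((r.solCoeff k).eval c) * X ^ p ^ k := by
  induction k with
  | zero =>
    simp [solCoeff, zero_pow (Fact.out : p.Prime).ne_zero]
    ring
  | succ k ih =>
    rw [Finset.sum_range_succ, add_pow_char, add_sub_add_comm, ih, Finset.sum_range_succ _ (k + 1),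
      solCoeff]
    simp only [mul_pow, eval_sub, eval_pow, eval_mul, eval_C, eval_X, C_sub, C_mul, C_pow,
      ← pow_mul, ← pow_succ]
    ring

theorem sol_pow_sub (r : AddPoly p h) {c : K p} (hc : c ∈ r.W) :
    r.sol c ^ p - r.sol c = C c * r.R + X * C (r.R.eval c) := by
  have h1 := r.sum_solCoeff_pow_sub c h
  rw [solCoeff_self, eval_neg, (r.mem_W c).1 hc, ← R_eq_sum_range] at h1
  simpa [sol] using h1

theorem coeff_R (r : AddPoly p h) (i : ℕ) : r.R.coeff (p ^ i) = r.coeffN i := by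
  have hp1 : 1 < p := (Fact.out : p.Prime).one_lt
  simp only [R_eq_sum_range, finsetSum_coeff, coeff_C_mul, coeff_X_pow,
    Nat.pow_right_inj hp1, mul_ite, mul_one, mul_zero, Finset.sum_ite_eq, Finset.mem_range]
  simp only [coeffN, ite_eq_left_iff]
  intro hi
  rw [dif_neg hi]

/-- Comparing coefficients of `X ^ (p ^ i)` in the equation for `Q` gives the recursion that
defines `solCoeff`. -/
theorem coeff_eq_eval_solCoeff (r : AddPoly p h) {c e : K p} {Q : (K p)[X]}
    (hQ : Q ^ p - Q = C c * r.R + X * C (r.R.eval c) + C e) (i : ℕ) :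
    Q.coeff (p ^ i) = (r.solCoeff i).eval c := by
  have hp1 : 1 < p := (Fact.out : p.Prime).one_lt
  induction i with
  | zero =>
    have h1 := congrArg (coeff · 1) hQ
    have h2 := r.coeff_R 0
    rw [pow_zero] at h2
    simp [coeff_pow_char_one, h2, coeff_C] at h1
    simp [solCoeff]
    linear_combination -h1
  | succ i ih =>
    have hne : 1 < p ^ (i + 1) := Nat.one_lt_pow (by omega) hp1
    have h1 := congrArg (coeff · (p ^ (i + 1))) hQ
    have h3 : (X : (K p)[X]).coeff (p ^ (i + 1)) = 0 := by rw [coeff_X, if_neg hne.ne]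
    have h4 : (C e : (K p)[X]).coeff (p ^ (i + 1)) = 0 := by
      rw [coeff_C, if_neg (by omega)]
    have h5 : (Q ^ p).coeff (p ^ (i + 1)) = Q.coeff (p ^ i) ^ p := by
      rw [pow_succ, coeff_pow_char]
    simp only [coeff_sub, coeff_add, coeff_C_mul, coeff_mul_C, coeff_R, h3, h4, h5, ih] at h1
    simp [solCoeff]
    linear_combination -h1

theorem mem_W_of_sol (r : AddPoly p h) {c e : K p} {Q : (K p)[X]}
    (hQ : Q ^ p - Q = C c * r.R + X * C (r.R.eval c) + C e) : c ∈ r.W := by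
  have hp1 : 1 < p := (Fact.out : p.Prime).one_lt
  have h1 : ∀ j, (r.solCoeff (h + j)).eval c = (r.solCoeff h).eval c ^ p ^ j := by
    intro j
    induction j with
    | zero => simp
    | succ j ih =>
      have : r.coeffN (h + j + 1) = 0 := dif_neg (by omega)
      rw [← add_assoc, solCoeff, this, eval_sub, eval_pow, ih, ← pow_mul, ← pow_succ]
      simp
  -- the exponents `p ^ i` exceed the degree of `Q` for large `i`
  have h2 := r.coeff_eq_eval_solCoeff hQ (h + Q.natDegree)
  rw [h1, coeff_eq_zero_of_natDegree_lt, solCoeff_self, eval_neg] at h2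
  · rw [mem_W]
    exact neg_eq_zero.1 (pow_eq_zero_iff (pow_pos (by omega) _).ne' |>.1 h2.symm)
  · exact (Nat.lt_pow_self hp1).trans_le (Nat.pow_le_pow_right (by omega) (by omega))

theorem eq_sol_add_C (r : AddPoly p h) {c e : K p} {Q : (K p)[X]}
    (hQ : Q ^ p - Q = C c * r.R + X * C (r.R.eval c) + C e) : ∃ b, Q = r.sol c + C b := by
  have h1 := r.sol_pow_sub (r.mem_W_of_sol hQ)
  obtain ⟨b, hb⟩ := eq_C_of_pow_char_sub_eq_C (p := p) (Q := Q - r.sol c) (e := e) (by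
    rw [sub_pow_char]
    linear_combination hQ - h1)
  exact ⟨b, by rw [← hb]; ring⟩

/-- The alternating form `(c, d) ↦ B_c(d) - B_d(c)` on `W`, where `B_c = sol c`, has trivial
radical: as a polynomial in `d` it has degree `p ^ (2 * h - 1)`, which is less than the number of
elements of `W`. -/
theorem eq_zero_of_eval_sol_comm (r : AddPoly p h) (hh : 1 ≤ h) {c : K p}
    (hc : ∀ d ∈ r.W, (r.sol c).eval d = (r.sol d).eval c) : c = 0 := by
  have hp1 : 1 < p := (Fact.out : p.Prime).one_lt
  by_contra h0
  obtain ⟨k, rfl⟩ : ∃ k, h = k + 1 := ⟨h - 1, by omega⟩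
  have hlow : (∑ i ∈ Finset.range k, r.solCoeff i * C (c ^ p ^ i) - r.sol c).natDegree <
      p ^ (k + 1 + k) := by
    refine (natDegree_sub_le _ _).trans_lt (max_lt ?_ ?_)
    · refine (natDegree_sum_le _ _).trans_lt ?_
      rw [Finset.fold_max_lt]
      refine ⟨pow_pos (by omega) _, fun i hi => ?_⟩
      refine (natDegree_mul_C_le _ _).trans_lt ?_
      rw [natDegree_solCoeff r hh]
      exact Nat.pow_lt_pow_right hp1 (by simpa using hi)
    · refine (natDegree_sum_le _ _).trans_lt ?_
      rw [Finset.fold_max_lt]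
      refine ⟨pow_pos (by omega) _, fun i hi => ?_⟩
      refine (natDegree_C_mul_X_pow_le _ _).trans_lt ?_
      exact Nat.pow_lt_pow_right hp1 (by simp at hi; omega)
  have htop : (r.solCoeff k * C (c ^ p ^ k)).natDegree = p ^ (k + 1 + k) := by
    rw [natDegree_mul_C (pow_ne_zero _ h0), natDegree_solCoeff r hh]
  have hdeg : (r.solCoeff k * C (c ^ p ^ k) +
      (∑ i ∈ Finset.range k, r.solCoeff i * C (c ^ p ^ i) - r.sol c)).natDegree =
      p ^ (k + 1 + k) := by
    rw [natDegree_add_eq_left_of_natDegree_lt (by rwa [htop]), htop]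
  have hzero := r.eq_zero_of_eval_W_eq_zero hh
    (hdeg.trans_lt (Nat.pow_lt_pow_right hp1 (by omega))) (fun d hd => by
      have h1 := hc d hd
      conv_rhs at h1 => rw [sol]
      rw [eval_finsetSum, Finset.sum_range_succ] at h1
      simp only [eval_mul, eval_C, eval_pow, eval_X] at h1
      simp only [eval_add, eval_sub, eval_mul, eval_C, eval_finsetSum]
      rw [h1]
      ring)
  rw [hzero, natDegree_zero] at hdeg
  exact (pow_pos (by omega : 0 < p) _).ne hdeg

end AddPoly

end

/-! ### The coordinate ring of the affine curve -/

section

variable {p : ℕ} [Fact p.Prime] {h : ℕ}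

namespace AddPoly

theorem monic_equation (r : AddPoly p h) : r.equation.Monic := by
  have hp1 : 1 < p := (Fact.out : p.Prime).one_lt
  rw [equation, sub_sub]
  exact monic_X_pow_sub (by rw [degree_X_add_C]; exact_mod_cast hp1)

theorem derivative_equation (r : AddPoly p h) : derivative r.equation = -1 := by
  have : CharP (RatFunc (K p)) p :=
    charP_of_injective_algebraMap (algebraMap (K p) (RatFunc (K p))).injective p
  simp [equation, derivative_X_pow]

theorem separable_equation (r : AddPoly p h) : r.equation.Separable := by
  rw [Polynomial.Separable, derivative_equation]
  exact isCoprime_one_right.neg_right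

variable [Fact (p ≠ 2)]

instance (r : AddPoly p h) : CharP r.FunctionField p :=
  charP_of_injective_algebraMap (algebraMap (K p) r.FunctionField).injective p

theorem algebraMap_polynomial (r : AddPoly p h) (g : (K p)[X]) :
    algebraMap (K p)[X] r.FunctionField g = aeval r.x g := by
  rw [r.aeval_x g, IsScalarTower.algebraMap_apply (K p)[X] (RatFunc (K p)) r.FunctionField]
  rfl

theorem isIntegral_y (r : AddPoly p h) : IsIntegral (K p)[X] r.y := by
  have hp1 : 1 < p := (Fact.out : p.Prime).one_lt
  refine ⟨X ^ p - (X + C (X * r.R)), monic_X_pow_sub ?_, ?_⟩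
  · rw [degree_X_add_C]; exact_mod_cast hp1
  · rw [eval₂_sub, eval₂_pow, eval₂_add, eval₂_X, eval₂_C, algebraMap_polynomial, map_mul, aeval_X,
      ← y_equation]
    ring

instance (r : AddPoly p h) : FiniteDimensional (RatFunc (K p)) r.FunctionField :=
  (AdjoinRoot.powerBasis' r.monic_equation).finite

instance (r : AddPoly p h) : Algebra.IsSeparable (RatFunc (K p)) r.FunctionField := by
  let B := AdjoinRoot.powerBasis' r.monic_equation
  have hB : IntermediateField.adjoin (RatFunc (K p)) {B.gen} = ⊤ := by
    rw [← top_le_iff]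
    intro z _
    have := B.adjoin_gen_eq_top
    exact IntermediateField.algebra_adjoin_le_adjoin _ _ (this ▸ Algebra.mem_top : z ∈ _)
  have h1 : Algebra.IsSeparable (RatFunc (K p))
      (IntermediateField.adjoin (RatFunc (K p)) {B.gen}) := by
    rw [IntermediateField.isSeparable_adjoin_simple_iff_isSeparable]
    refine r.separable_equation.of_dvd (minpoly.dvd _ _ ?_)
    rw [aeval_def]
    exact AdjoinRoot.eval₂_root r.equation
  rw [hB] at h1
  exact AlgEquiv.Algebra.isSeparable IntermediateField.topEquiv

/-- The affine curve is smooth: its coordinate ring is integrally closed, as the discriminant of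
`Y ^ p - Y - x * R(x)` is a unit. -/
theorem mem_adjoin_y_of_isIntegral (r : AddPoly p h) {z : r.FunctionField}
    (hz : IsIntegral (K p)[X] z) : z ∈ Algebra.adjoin (K p)[X] {r.y} := by
  let B := AdjoinRoot.powerBasis' r.monic_equation
  have hgen : B.gen = r.y := rfl
  have hmin : minpoly (RatFunc (K p)) B.gen = r.equation := by
    refine (minpoly.eq_of_irreducible_of_monic (Fact.out : Irreducible r.equation) ?_
      r.monic_equation).symm
    rw [aeval_def]
    exact AdjoinRoot.eval₂_root r.equation
  have hd := Algebra.discr_powerBasis_eq_norm (RatFunc (K p)) B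
  rw [hmin, derivative_equation] at hd
  have hd2 : Algebra.discr (RatFunc (K p)) B.basis * Algebra.discr (RatFunc (K p)) B.basis = 1 := by
    rw [hd, mul_mul_mul_comm, ← mul_pow, ← map_mul]
    simp
  have h1 := Algebra.discr_mul_isIntegral_mem_adjoin (R := (K p)[X]) (RatFunc (K p)) (B := B)
    (hgen ▸ r.isIntegral_y) hz
  rw [hgen] at h1
  have hd3 : Algebra.discr (RatFunc (K p)) B.basis = 1 ∨
    Algebra.discr (RatFunc (K p)) B.basis = -1 := mul_self_eq_one_iff.1 hd2
  rcases hd3 with h2 | h2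
  · rwa [h2, one_smul] at h1
  · rw [h2, neg_smul, one_smul] at h1
    simpa using neg_mem h1

theorem exists_mul_eq_aeval_x (r : AddPoly p h) (z : r.FunctionField) :
    ∃ g : (K p)[X], g ≠ 0 ∧ aeval r.x g * z ∈ Algebra.adjoin (K p)[X] {r.y} := by
  have : Algebra.IsAlgebraic (K p)[X] r.FunctionField :=
    (IsFractionRing.comap_isAlgebraic_iff (K := RatFunc (K p))).2 inferInstance
  obtain ⟨g, hg, hz⟩ := (Algebra.IsAlgebraic.isAlgebraic (R := (K p)[X]) z).exists_integral_multiple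
  refine ⟨g, hg, ?_⟩
  rw [← algebraMap_polynomial, ← Algebra.smul_def]
  exact r.mem_adjoin_y_of_isIntegral hz

/-- Every regular function on the affine curve is a polynomial in `x` and `y` of degree less
than `p` in `y`. -/
theorem exists_aeval_y_eq (r : AddPoly p h) {z : r.FunctionField}
    (hz : z ∈ Algebra.adjoin (K p)[X] {r.y}) :
    ∃ g : (K p)[X][X], g.natDegree < p ∧ aeval r.y g = z := by
  have hp1 : 1 < p := (Fact.out : p.Prime).one_lt
  rw [Algebra.adjoin_singleton_eq_range_aeval] at hz
  obtain ⟨g, rfl⟩ := hz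
  have hdeg : (X + C (X * r.R) : (K p)[X][X]).degree < (p : ℕ) := by
    rw [degree_X_add_C]; exact_mod_cast hp1
  have hm : (X ^ p - (X + C (X * r.R)) : (K p)[X][X]).Monic := monic_X_pow_sub hdeg
  have hnat : (X ^ p - (X + C (X * r.R)) : (K p)[X][X]).natDegree = p := by
    rw [natDegree_sub_eq_left_of_natDegree_lt, natDegree_X_pow]
    rwa [natDegree_X_add_C, natDegree_X_pow]
  refine ⟨g %ₘ (X ^ p - (X + C (X * r.R))), ?_, ?_⟩
  · have := natDegree_modByMonic_lt g hm (fun h1 => by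
      rw [h1, natDegree_one] at hnat; omega)
    rwa [hnat] at this
  · have h0 : aeval r.y (X ^ p - (X + C (X * r.R)) : (K p)[X][X]) = 0 := by
      rw [map_sub, map_add, map_pow, aeval_X, aeval_C, algebraMap_polynomial, map_mul, aeval_X,
        ← y_equation]
      ring
    conv_rhs => rw [AlgHom.toRingHom_eq_coe, RingHom.coe_coe,
      ← modByMonic_add_div g (X ^ p - (X + C (X * r.R))), map_add, map_mul (aeval r.y), h0,
      zero_mul, add_zero]

end AddPoly

end

/-! ### Places at infinity and pole orders -/

section

variable {p : ℕ} [Fact p.Prime] {h : ℕ}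

namespace AddPoly

/-- The pole order at infinity of the function `g(x, y)`, for `g` of degree less than `p` in `Y`:
the functions `x` and `y` have poles of order `p` and `p ^ h + 1`, and no two monomials
`x ^ i * y ^ j` with `j < p` have the same pole order if `1 ≤ h`. -/
def poleOrder (h : ℕ) (g : (K p)[X][X]) : ℕ :=
  g.support.sup fun j => p * (g.coeff j).natDegree + (p ^ h + 1) * j

theorem le_poleOrder (h : ℕ) {g : (K p)[X][X]} {j : ℕ} (hj : g.coeff j ≠ 0) :
    p * (g.coeff j).natDegree + (p ^ h + 1) * j ≤ poleOrder h g :=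
  Finset.le_sup (f := fun j => p * (g.coeff j).natDegree + (p ^ h + 1) * j)
    (mem_support_iff.2 hj)

variable [Fact (p ≠ 2)]

/-- As `y` is integral over `k[x]`, it is regular wherever `x` is. -/
theorem x_notMem_of_isInfinite (r : AddPoly p h) {v : ValuationSubring r.FunctionField}
    (hv : r.IsInfinite v) : r.x ∉ v := by
  have hp1 : 1 < p := (Fact.out : p.Prime).one_lt
  intro hx
  refine hv.2 ⟨hx, ?_⟩
  by_contra hy
  rw [← v.valuation_le_one_iff, not_le] at hy
  have h1 : r.x * aeval r.x r.R ∈ v := by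
    refine mul_mem hx ?_
    rw [aeval_eq_sum_range]
    refine sum_mem fun i _ => ?_
    rw [Algebra.smul_def]
    exact mul_mem (hv.1.1 _) (pow_mem hx i)
  rw [← y_equation, ← v.valuation_le_one_iff, Valuation.map_sub_eq_of_lt_left, map_pow] at h1
  · exact (one_lt_pow₀ hy (by omega)).not_ge h1
  · rw [map_pow]
    exact lt_self_pow₀ hy hp1

theorem isInfinite_iff (r : AddPoly p h) {v : ValuationSubring r.FunctionField} :
    r.IsInfinite v ↔ (∀ c : K p, algebraMap (K p) r.FunctionField c ∈ v) ∧ r.x ∉ v := by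
  refine ⟨fun hv => ⟨hv.1.1, r.x_notMem_of_isInfinite hv⟩,
    fun hv => ⟨⟨hv.1, ?_⟩, fun h1 => hv.2 h1.1⟩⟩
  rintro rfl
  exact hv.2 trivial

theorem isTrivialOn_of_isInfinite (r : AddPoly p h) {v : ValuationSubring r.FunctionField}
    (hv : r.IsInfinite v) : v.valuation.IsTrivialOn (K p) := by
  refine ⟨fun a ha => le_antisymm ((v.valuation_le_one_iff _).2 (hv.1.1 a)) ?_⟩
  have h1 := (v.valuation_le_one_iff _).2 (hv.1.1 a⁻¹)
  rw [map_inv₀, map_inv₀] at h1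
  have h2 : 0 < v.valuation (algebraMap (K p) r.FunctionField a) := by
    rw [Valuation.pos_iff]
    simpa using ha
  exact (inv_le_one₀ h2).1 h1

theorem one_lt_valuation_x (r : AddPoly p h) {v : ValuationSubring r.FunctionField}
    (hv : r.IsInfinite v) : 1 < v.valuation r.x := by
  rw [← not_le, v.valuation_le_one_iff]
  exact r.x_notMem_of_isInfinite hv

theorem valuation_aeval_x (r : AddPoly p h) {v : ValuationSubring r.FunctionField}
    (hv : r.IsInfinite v) {g : (K p)[X]} (hg : g ≠ 0) :
    v.valuation (aeval r.x g) = v.valuation r.x ^ g.natDegree :=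
  have := r.isTrivialOn_of_isInfinite hv
  valuation_aeval_eq_valuation_X_pow_natDegree_of_one_lt_valuation_X _
    (r.one_lt_valuation_x hv) hg

theorem valuation_y_pow (r : AddPoly p h) {v : ValuationSubring r.FunctionField}
    (hv : r.IsInfinite v) : v.valuation r.y ^ p = v.valuation r.x ^ (p ^ h + 1) := by
  have hp1 : 1 < p := (Fact.out : p.Prime).one_lt
  have h1 : v.valuation (r.y ^ p - r.y) = v.valuation r.x ^ (p ^ h + 1) := by
    rw [y_equation, map_mul, r.valuation_aeval_x hv r.R_ne_zero, natDegree_R,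
      pow_succ']
  have h2 : 1 < v.valuation r.x ^ (p ^ h + 1) := one_lt_pow₀ (r.one_lt_valuation_x hv) (by omega)
  have h3 : 1 < v.valuation r.y := by
    by_contra h4
    rw [not_lt, v.valuation_le_one_iff] at h4
    rw [← h1] at h2
    exact h2.not_ge ((v.valuation_le_one_iff _).2 (sub_mem (pow_mem h4 p) h4))
  rw [← h1, Valuation.map_sub_eq_of_lt_left, map_pow]
  rw [map_pow]
  exact lt_self_pow₀ h3 hp1

theorem valuation_aeval_y_pow (r : AddPoly p h) (hh : 1 ≤ h)
    {v : ValuationSubring r.FunctionField} (hv : r.IsInfinite v) {g : (K p)[X][X]}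
    (hg : g ≠ 0) (hdeg : g.natDegree < p) :
    v.valuation (aeval r.y g) ^ p = v.valuation r.x ^ poleOrder h g := by
  classical
  have hp1 : 1 < p := (Fact.out : p.Prime).one_lt
  have hterm : ∀ i ∈ g.support, v.valuation (aeval r.x (g.coeff i) * r.y ^ i) ^ p =
      v.valuation r.x ^ (p * (g.coeff i).natDegree + (p ^ h + 1) * i) := by
    intro i hi
    rw [map_mul, map_pow, mul_pow, ← pow_mul, mul_comm i p, pow_mul _ p i, r.valuation_y_pow hv,
      r.valuation_aeval_x hv (mem_support_iff.1 hi), ← pow_mul, ← pow_mul,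
      ← pow_add, mul_comm p]
  obtain ⟨j, hj, hsup⟩ := Finset.exists_mem_eq_sup g.support (support_nonempty.2 hg)
    fun j => p * (g.coeff j).natDegree + (p ^ h + 1) * j
  -- as `p` divides `p ^ h`, the exponent `j` is determined by the pole order modulo `p`
  have hmod : ∀ i ∈ g.support, (p * (g.coeff i).natDegree + (p ^ h + 1) * i) % p = i := by
    intro i hi
    have h1 : i < p := (le_natDegree_of_mem_supp i hi).trans_lt hdeg
    obtain ⟨k, rfl⟩ : ∃ k, h = k + 1 := ⟨h - 1, by omega⟩
    have h2 : p * (g.coeff i).natDegree + (p ^ (k + 1) + 1) * i =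
        i + p * ((g.coeff i).natDegree + p ^ k * i) := by ring
    rw [h2, Nat.add_mul_mod_self_left, Nat.mod_eq_of_lt h1]
  have hsum : aeval r.y g = ∑ i ∈ g.support, aeval r.x (g.coeff i) * r.y ^ i := by
    simp only [aeval_def r.y g, eval₂_eq_sum, Polynomial.sum, algebraMap_polynomial]
  have hval : v.valuation (aeval r.y g) = v.valuation (aeval r.x (g.coeff j) * r.y ^ j) := by
    rw [hsum]
    refine Valuation.map_sum_eq_of_lt _ hj fun i hi => ?_
    rw [Finset.mem_sdiff, Finset.mem_singleton] at hi
    refine lt_of_pow_lt_pow_left₀ p zero_le ?_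
    rw [hterm i hi.1, hterm j hj]
    refine pow_lt_pow_right₀ (r.one_lt_valuation_x hv) (lt_of_le_of_ne ?_ ?_)
    · rw [← hsup]
      exact le_poleOrder h (mem_support_iff.1 hi.1)
    · intro h1
      have h2 := hmod i hi.1
      rw [h1, hmod j hj] at h2
      exact hi.2 h2.symm
  rw [hval, hterm j hj, ← hsup, poleOrder]

theorem aeval_y_ne_zero (r : AddPoly p h) (hh : 1 ≤ h)
    {v : ValuationSubring r.FunctionField} (hv : r.IsInfinite v) {g : (K p)[X][X]}
    (hg : g ≠ 0) (hdeg : g.natDegree < p) : aeval r.y g ≠ 0 := by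
  intro h0
  have h1 := r.valuation_aeval_y_pow hh hv hg hdeg
  rw [h0, map_zero, zero_pow (Fact.out : p.Prime).ne_zero] at h1
  exact (pow_pos (zero_lt_one.trans (r.one_lt_valuation_x hv)) _).ne h1

theorem valuation_le_valuation_iff (r : AddPoly p h) (hh : 1 ≤ h)
    {v : ValuationSubring r.FunctionField} (hv : r.IsInfinite v) {f g : (K p)[X][X]}
    (hf : f ≠ 0) (hfdeg : f.natDegree < p) (hg : g ≠ 0) (hgdeg : g.natDegree < p) :
    v.valuation (aeval r.y f) ≤ v.valuation (aeval r.y g) ↔ poleOrder h f ≤ poleOrder h g := by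
  rw [← pow_le_pow_iff_left₀ zero_le zero_le (Fact.out : p.Prime).ne_zero,
    r.valuation_aeval_y_pow hh hv hf hfdeg, r.valuation_aeval_y_pow hh hv hg hgdeg,
    pow_le_pow_iff_right₀ (r.one_lt_valuation_x hv)]

theorem algebraMap_polynomial_injective (r : AddPoly p h) :
    Function.Injective (algebraMap (K p)[X] r.FunctionField) := by
  rw [IsScalarTower.algebraMap_eq (K p)[X] (RatFunc (K p)) r.FunctionField]
  exact (algebraMap (RatFunc (K p)) r.FunctionField).injective.comp
    (RatFunc.algebraMap_injective (K p))

/-- The algebraically closed field `k` is integrally closed in the function field, so it is the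
intersection of the valuation subrings that contain it, and one of them does not contain `x`. -/
theorem exists_isInfinite (r : AddPoly p h) : ∃ v, r.IsInfinite v := by
  let k := (algebraMap (K p) r.FunctionField).range
  have hk : IsIntegrallyClosedIn k r.FunctionField := by
    refine Subring.isIntegrallyClosedIn_iff.2 fun {z} hz => ?_
    have hz : IsIntegral (K p) z := by
      obtain ⟨P, hP, hPz⟩ := hz
      obtain ⟨Q, hQ, -, hQm⟩ := lifts_and_degree_eq_and_monic
        (f := (algebraMap (K p) r.FunctionField).rangeRestrict) (p := P)
        ((mem_lifts _).2 (map_surjective _ (RingHom.rangeRestrict_surjective _) P)) hP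
      refine ⟨Q, hQm, ?_⟩
      rw [← hQ, eval₂_map] at hPz
      exact hPz
    have h1 := IsAlgClosed.degree_eq_one_of_irreducible (K p) (minpoly.irreducible hz)
    exact minpoly.mem_range_of_degree_eq_one (K p) z h1
  have hx : r.x ∉ k := by
    rintro ⟨c, hc⟩
    have h1 : aeval r.x (X - C c) = 0 := by simp [hc]
    rw [← algebraMap_polynomial, map_eq_zero_iff _ r.algebraMap_polynomial_injective] at h1
    exact X_sub_C_ne_zero c h1
  obtain ⟨v, hkv, hxv⟩ := Subring.exists_le_valuationSubring_of_isIntegrallyClosedIn hx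
  exact ⟨v, r.isInfinite_iff.2 ⟨fun c => hkv ⟨c, rfl⟩, hxv⟩⟩

theorem exists_div_eq (r : AddPoly p h) {z : r.FunctionField} (hz : z ≠ 0) :
    ∃ f g : (K p)[X][X], f ≠ 0 ∧ f.natDegree < p ∧ g ≠ 0 ∧ g.natDegree < p ∧
      z = aeval r.y f / aeval r.y g := by
  obtain ⟨q, hq, hqz⟩ := r.exists_mul_eq_aeval_x z
  obtain ⟨f, hf, hfz⟩ := r.exists_aeval_y_eq hqz
  have hq0 : aeval r.x q ≠ 0 := by
    rw [← algebraMap_polynomial, Ne, map_eq_zero_iff _ r.algebraMap_polynomial_injective]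
    exact hq
  have hgq : aeval r.y (C q) = aeval r.x q := by rw [aeval_C, algebraMap_polynomial]
  refine ⟨f, C q, ?_, hf, C_ne_zero.2 hq, by simpa using (Fact.out : p.Prime).pos, ?_⟩
  · rintro rfl
    rw [map_zero] at hfz
    exact mul_ne_zero hq0 hz hfz.symm
  · rw [hgq, hfz, mul_div_cancel_left₀ _ hq0]

/-- Whether a quotient of regular functions belongs to the local ring of an infinite place depends
only on the pole orders of the numerator and the denominator, which do not involve the place. -/
theorem isInfinite_unique (r : AddPoly p h) (hh : 1 ≤ h) {v w : ValuationSubring r.FunctionField}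
    (hv : r.IsInfinite v) (hw : r.IsInfinite w) : v = w := by
  have key : ∀ u : ValuationSubring r.FunctionField, r.IsInfinite u →
      ∀ f g : (K p)[X][X], f ≠ 0 → f.natDegree < p → g ≠ 0 → g.natDegree < p →
      (aeval r.y f / aeval r.y g ∈ u ↔ poleOrder h f ≤ poleOrder h g) := by
    intro u hu f g hf hfd hg hgd
    rw [← r.valuation_le_valuation_iff hh hu hf hfd hg hgd, ← u.valuation_le_one_iff, map_div₀,
      div_le_one₀ (by rw [Valuation.pos_iff]; exact r.aeval_y_ne_zero hh hu hg hgd)]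
  ext z
  rcases eq_or_ne z 0 with rfl | hz
  · simp [zero_mem]
  · obtain ⟨f, g, hf, hfd, hg, hgd, rfl⟩ := r.exists_div_eq hz
    rw [key v hv f g hf hfd hg hgd, key w hw f g hf hfd hg hgd]

theorem existsUnique_isInfinite (r : AddPoly p h) (hh : 1 ≤ h) : ∃! v, r.IsInfinite v := by
  obtain ⟨v, hv⟩ := r.exists_isInfinite
  exact ⟨v, hv, fun w hw => r.isInfinite_unique hh hw hv⟩

theorem mem_Aut₀_iff (r : AddPoly p h) (hh : 1 ≤ h) {v : ValuationSubring r.FunctionField}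
    (hv : r.IsInfinite v) (σ : r.Aut) : σ ∈ r.Aut₀ ↔ ∀ z, σ z ∈ v ↔ z ∈ v := by
  have h1 : σ ∈ r.Aut₀ ↔ σ • v = v := by
    simp only [Aut₀, Subgroup.mem_iInf]
    refine ⟨fun h2 => h2 v hv, fun h2 w hw => ?_⟩
    rw [r.isInfinite_unique hh hw hv]
    exact h2
  rw [h1]
  constructor
  · intro h2 z
    conv_lhs => rw [← h2]
    exact ValuationSubring.smul_mem_pointwise_smul_iff (g := σ)
  · intro h2
    ext z
    rw [ValuationSubring.mem_pointwise_smul_iff_inv_smul_mem, ← h2]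
    exact Iff.of_eq (congrArg (· ∈ v) (σ.apply_symm_apply z))

theorem mem_of_mem_adjoin_y (r : AddPoly p h) {z : r.FunctionField}
    (hz : z ∈ Algebra.adjoin (K p)[X] {r.y}) {S : Subring r.FunctionField}
    (hk : ∀ c, algebraMap (K p) r.FunctionField c ∈ S) (hx : r.x ∈ S) (hy : r.y ∈ S) : z ∈ S := by
  induction hz using Algebra.adjoin_induction with
  | mem z hz => rwa [Set.mem_singleton_iff.1 hz]
  | algebraMap g =>
    rw [algebraMap_polynomial, aeval_eq_sum_range]
    refine sum_mem fun i _ => ?_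
    rw [Algebra.smul_def]
    exact mul_mem (hk _) (pow_mem hx i)
  | add _ _ _ _ h1 h2 => exact add_mem h1 h2
  | mul _ _ _ _ h1 h2 => exact mul_mem h1 h2

/-- A function that is regular at all points of the affine curve belongs to its coordinate ring. -/
theorem mem_adjoin_y_of_forall_mem (r : AddPoly p h) {z : r.FunctionField}
    (hz : ∀ w : ValuationSubring r.FunctionField, (∀ c, algebraMap (K p) r.FunctionField c ∈ w) →
      r.x ∈ w → r.y ∈ w → z ∈ w) : z ∈ Algebra.adjoin (K p)[X] {r.y} := by
  let A := Algebra.adjoin (K p)[X] {r.y}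
  have hA : IsIntegrallyClosedIn A.toSubring r.FunctionField := by
    refine Subring.isIntegrallyClosedIn_iff.2 fun {u} hu => r.mem_adjoin_y_of_isIntegral ?_
    have : Algebra.IsIntegral (K p)[X] A :=
      Algebra.IsIntegral.adjoin fun u hu => by
        rw [Set.mem_singleton_iff.1 hu]
        exact r.isIntegral_y
    exact isIntegral_trans (A := A) u hu
  by_contra hzA
  obtain ⟨w, hAw, hzw⟩ := Subring.exists_le_valuationSubring_of_isIntegrallyClosedIn
    (R := A.toSubring) hzA
  have hpoly : ∀ g : (K p)[X], aeval r.x g ∈ w := fun g => by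
    rw [← algebraMap_polynomial]
    exact hAw (A.algebraMap_mem g)
  refine hzw (hz w (fun c => ?_) ?_ (hAw (Algebra.self_mem_adjoin_singleton _ _)))
  · simpa using hpoly (C c)
  · simpa using hpoly X

/-- The automorphisms that fix infinity permute the other points, so they preserve the coordinate
ring of the affine curve. -/
theorem Aut₀_apply_mem_adjoin_y (r : AddPoly p h) (hh : 1 ≤ h) {σ : r.Aut} (hσ : σ ∈ r.Aut₀)
    {z : r.FunctionField} (hz : z ∈ Algebra.adjoin (K p)[X] {r.y}) :
    σ z ∈ Algebra.adjoin (K p)[X] {r.y} := by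
  refine r.mem_adjoin_y_of_forall_mem fun w hk hx hy => ?_
  have hmem : ∀ u, u ∈ σ⁻¹ • w ↔ σ u ∈ w := fun u =>
    ValuationSubring.mem_inv_pointwise_smul_iff (g := σ)
  have hk' : ∀ c, algebraMap (K p) r.FunctionField c ∈ σ⁻¹ • w := fun c => by
    rw [hmem, σ.commutes]
    exact hk c
  have hfin : r.x ∈ σ⁻¹ • w ∧ r.y ∈ σ⁻¹ • w := by
    by_contra h1
    have hinf : r.IsInfinite (σ⁻¹ • w) := by
      refine ⟨⟨hk', ?_⟩, h1⟩
      intro h2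
      exact h1 (h2 ▸ ⟨trivial, trivial⟩)
    refine r.x_notMem_of_isInfinite hinf ?_
    have h2 := (r.mem_Aut₀_iff hh hinf σ).1 hσ (σ.symm r.x)
    rw [hmem (σ.symm r.x), σ.apply_symm_apply] at h2
    exact h2.2 hx
  exact (hmem z).1 (r.mem_of_mem_adjoin_y (S := (σ⁻¹ • w).toSubring) hz hk' hfin.1 hfin.2)

end AddPoly

end

/-! ### Automorphisms that fix infinity -/

section

variable {p : ℕ} [Fact p.Prime] {h : ℕ}

namespace AddPoly

/-- A function whose pole order is less than that of `y` is a polynomial in `x`. -/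
theorem eq_C_of_poleOrder_lt {f : (K p)[X][X]} (hf : poleOrder h f < p ^ h + 1) :
    ∃ g : (K p)[X], f = C g ∧ p * g.natDegree ≤ poleOrder h f := by
  refine ⟨f.coeff 0, ?_, ?_⟩
  · ext1 j
    rw [coeff_C]
    split_ifs with hj
    · rw [hj]
    · by_contra h1
      have := le_poleOrder h h1
      have : p ^ h + 1 ≤ (p ^ h + 1) * j := Nat.le_mul_of_pos_right _ (Nat.pos_of_ne_zero hj)
      omega
  · by_cases h1 : f.coeff 0 = 0
    · simp [h1]
    · simpa using le_poleOrder h h1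

theorem eq_C_mul_X_add_C_of_poleOrder_le {f : (K p)[X][X]}
    (hf : poleOrder h f ≤ p ^ h + 1) : ∃ (c : K p) (g : (K p)[X]), f = C (C c) * X + C g := by
  have hp : 0 < p := (Fact.out : p.Prime).pos
  refine ⟨(f.coeff 1).coeff 0, f.coeff 0, ?_⟩
  have h1 : C ((f.coeff 1).coeff 0) = f.coeff 1 := by
    by_cases h0 : f.coeff 1 = 0
    · simp [h0]
    · refine (eq_C_of_natDegree_eq_zero ?_).symm
      have := le_poleOrder h h0
      have h2 : p * (f.coeff 1).natDegree = 0 := by omega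
      exact (Nat.mul_eq_zero.1 h2).resolve_left hp.ne'
  rw [h1]
  have hdeg : f.degree ≤ 1 := by
    rw [degree_le_iff_coeff_zero]
    intro j hj
    by_contra h0
    have h2 := le_poleOrder h h0
    have h3 : 2 ≤ j := by
      have : 1 < j := by exact_mod_cast hj
      omega
    have h4 : (p ^ h + 1) * 2 ≤ (p ^ h + 1) * j := Nat.mul_le_mul_left _ h3
    omega
  exact eq_X_add_C_of_degree_le_one hdeg

variable [Fact (p ≠ 2)]

theorem aeval_x_injective (r : AddPoly p h) :
    Function.Injective (aeval r.x : (K p)[X] →ₐ[K p] r.FunctionField) := fun f g hfg => by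
  rw [← algebraMap_polynomial, ← algebraMap_polynomial] at hfg
  exact r.algebraMap_polynomial_injective hfg

/-- The function `y` is not a polynomial in `x`. -/
theorem eq_zero_of_mul_y_eq_aeval_x (r : AddPoly p h) (hh : 1 ≤ h) {c : K p} {g : (K p)[X]}
    (hc : algebraMap (K p) r.FunctionField c * r.y = aeval r.x g) : c = 0 := by
  obtain ⟨v, hv⟩ := r.exists_isInfinite
  by_contra h0
  have hdeg : (C (C c) * X - C g : (K p)[X][X]).natDegree ≤ 1 :=
    (natDegree_sub_C (a := g)).trans_le ((natDegree_C_mul_le _ _).trans natDegree_X_le)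
  refine r.aeval_y_ne_zero hh hv (g := C (C c) * X - C g) ?_
    (hdeg.trans_lt (Fact.out : p.Prime).one_lt) ?_
  · intro h1
    have h2 := congrArg (coeff · 1) h1
    simp [coeff_C] at h2
    exact h0 h2
  · rw [map_sub, map_mul, aeval_X, aeval_C, aeval_C, algebraMap_polynomial, algebraMap_polynomial,
      aeval_C, hc, sub_self]

theorem valuation_apply_le_iff (r : AddPoly p h) (hh : 1 ≤ h)
    {v : ValuationSubring r.FunctionField} (hv : r.IsInfinite v) {σ : r.Aut} (hσ : σ ∈ r.Aut₀)
    (a : r.FunctionField) {b : r.FunctionField} (hb : b ≠ 0) :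
    v.valuation (σ a) ≤ v.valuation (σ b) ↔ v.valuation a ≤ v.valuation b := by
  have h1 : ∀ a {b : r.FunctionField}, b ≠ 0 → (v.valuation a ≤ v.valuation b ↔ a / b ∈ v) := by
    intro a b hb
    rw [← v.valuation_le_one_iff, map_div₀, div_le_one₀ (by rwa [Valuation.pos_iff])]
  rw [h1 _ ((map_ne_zero_iff _ σ.injective).2 hb), h1 _ hb, ← map_div₀,
    (r.mem_Aut₀_iff hh hv σ).1 hσ]

/-- If `σ` maps no regular function of smaller pole order than `z = g(x, y)` to `z`, then the pole
order of `σ z` is at most that of `z`: `σ⁻¹ z` is regular, so its pole order is at least that of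
`z`, and `σ` preserves the ordering by pole order. -/
theorem exists_apply_eq (r : AddPoly p h) (hh : 1 ≤ h) {σ : r.Aut} (hσ : σ ∈ r.Aut₀)
    {g : (K p)[X][X]} (hg : g ≠ 0) (hgd : g.natDegree < p)
    (hmin : ∀ f : (K p)[X][X], poleOrder h f < poleOrder h g → σ (aeval r.y f) ≠ aeval r.y g) :
    ∃ f : (K p)[X][X], σ (aeval r.y g) = aeval r.y f ∧ poleOrder h f ≤ poleOrder h g := by
  obtain ⟨v, hv⟩ := r.exists_isInfinite
  have hmem : aeval r.y g ∈ Algebra.adjoin (K p)[X] {r.y} := by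
    rw [Algebra.adjoin_singleton_eq_range_aeval]
    exact ⟨g, rfl⟩
  have hg0 := r.aeval_y_ne_zero hh hv hg hgd
  obtain ⟨f, hfd, hf⟩ := r.exists_aeval_y_eq (r.Aut₀_apply_mem_adjoin_y hh hσ hmem)
  obtain ⟨f', hfd', hf'⟩ := r.exists_aeval_y_eq
    (r.Aut₀_apply_mem_adjoin_y hh (r.Aut₀.inv_mem hσ) hmem)
  have hσf' : σ (aeval r.y f') = aeval r.y g := by
    rw [hf']
    exact σ.apply_symm_apply _
  have hf0 : f ≠ 0 := by
    rintro rfl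
    rw [map_zero, eq_comm, map_eq_zero_iff _ σ.injective] at hf
    exact hg0 hf
  have hf0' : f' ≠ 0 := by
    rintro rfl
    rw [map_zero, map_zero] at hσf'
    exact hg0 hσf'.symm
  have h1 : poleOrder h g ≤ poleOrder h f' := not_lt.1 fun h2 => hmin f' h2 hσf'
  rw [← r.valuation_le_valuation_iff hh hv hg hgd hf0' hfd',
    ← r.valuation_apply_le_iff hh hv hσ _ (r.aeval_y_ne_zero hh hv hf0' hfd'), hσf', ← hf,
    r.valuation_le_valuation_iff hh hv hf0 hfd hg hgd] at h1
  exact ⟨f, hf.symm, h1⟩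

theorem Aut₀_apply_x (r : AddPoly p h) (hh : 1 ≤ h) {σ : r.Aut} (hσ : σ ∈ r.Aut₀) :
    ∃ a b : K p, σ r.x = algebraMap (K p) r.FunctionField a * r.x + algebraMap (K p) _ b := by
  have hp : 0 < p := (Fact.out : p.Prime).pos
  have hlt : p < p ^ h + 1 := Nat.lt_succ_of_le (Nat.le_self_pow (by omega) p)
  have hX : aeval r.y (C X : (K p)[X][X]) = r.x := by
    rw [aeval_C, algebraMap_polynomial, aeval_X]
  have hpole : poleOrder h (C X : (K p)[X][X]) = p := by
    rw [poleOrder, support_C X_ne_zero]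
    simp
  obtain ⟨f, hf, hfp⟩ := r.exists_apply_eq hh hσ (g := C X) (C_ne_zero.2 X_ne_zero)
    (by simpa using hp) (fun f hf h1 => by
      rw [hpole] at hf
      obtain ⟨g, rfl, hg⟩ := eq_C_of_poleOrder_lt (hf.trans hlt)
      have hg0 : g.natDegree = 0 := by
        by_contra h0
        have : p * 1 ≤ p * g.natDegree := Nat.mul_le_mul_left _ (Nat.pos_of_ne_zero h0)
        omega
      rw [eq_C_of_natDegree_eq_zero hg0, hX, aeval_C, algebraMap_polynomial, aeval_C, σ.commutes,
        ← aeval_C r.x, ← aeval_X (R := K p) r.x] at h1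
      exact X_ne_C _ (r.aeval_x_injective (by simpa using h1.symm)))
  rw [hpole] at hfp
  obtain ⟨g, rfl, hg⟩ := eq_C_of_poleOrder_lt (hfp.trans_lt hlt)
  have hg1 : g.natDegree ≤ 1 := by
    by_contra h0
    have : p * 2 ≤ p * g.natDegree := Nat.mul_le_mul_left _ (by omega)
    omega
  obtain ⟨a, b, rfl⟩ := exists_eq_X_add_C_of_natDegree_le_one hg1
  refine ⟨a, b, ?_⟩
  rw [← hX, hf, aeval_C, algebraMap_polynomial]
  simp [algebraMap_polynomial]

theorem Aut₀_apply_y (r : AddPoly p h) (hh : 1 ≤ h) {σ : r.Aut} (hσ : σ ∈ r.Aut₀) :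
    ∃ (c : K p) (Q : (K p)[X]), c ^ p = c ∧
      σ r.y = algebraMap (K p) r.FunctionField c * r.y + aeval r.x Q := by
  have hp1 : 1 < p := (Fact.out : p.Prime).one_lt
  obtain ⟨a, b, hab⟩ := r.Aut₀_apply_x hh hσ
  have hσx : ∀ g : (K p)[X], σ (aeval r.x g) = aeval r.x (g.comp (C a * X + C b)) := by
    intro g
    rw [aeval_comp, ← aeval_algHom_apply, hab]
    simp
  have hpole : poleOrder h (X : (K p)[X][X]) = p ^ h + 1 := by
    rw [poleOrder, support_X]
    simp
  obtain ⟨f, hf, hfp⟩ := r.exists_apply_eq hh hσ (g := X) X_ne_zero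
    (by simpa using hp1) (fun f hf h1 => by
      rw [hpole] at hf
      obtain ⟨g, rfl, -⟩ := eq_C_of_poleOrder_lt hf
      rw [aeval_X, aeval_C, algebraMap_polynomial, hσx] at h1
      exact one_ne_zero (r.eq_zero_of_mul_y_eq_aeval_x hh (c := 1)
        (by rw [map_one, one_mul]; exact h1.symm)))
  rw [hpole] at hfp
  obtain ⟨c, Q, rfl⟩ := eq_C_mul_X_add_C_of_poleOrder_le hfp
  rw [aeval_X, map_add, map_mul, aeval_X, aeval_C, aeval_C, algebraMap_polynomial,
    algebraMap_polynomial, aeval_C] at hf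
  refine ⟨c, Q, ?_, hf⟩
  -- the image of the equation of the curve under `σ` shows that `(c ^ p - c) * y` is in `k[x]`
  have h1 := congrArg σ r.y_equation
  have h2 := r.y_equation
  rw [← sub_eq_zero]
  refine r.eq_zero_of_mul_y_eq_aeval_x hh
    (g := (X * r.R).comp (C a * X + C b) - C (c ^ p) * (X * r.R) - (Q ^ p - Q)) ?_
  have h3 : σ (r.x * aeval r.x r.R) = aeval r.x ((X * r.R).comp (C a * X + C b)) := by
    rw [← hσx, map_mul, map_mul, aeval_X, map_mul]
  rw [h3, map_sub, map_pow, hf, add_pow_char, mul_pow, ← map_pow] at h1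
  simp only [map_sub, ← h1, map_mul, aeval_C, aeval_X, ← h2, map_pow]
  ring

end AddPoly

end

/-! ### Automorphisms that shift `x` -/

section

variable {p : ℕ} [Fact p.Prime] {h : ℕ}

namespace AddPoly

theorem comp_R (r : AddPoly p h) (c : K p) : r.R.comp (X + C c) = r.R + C (r.R.eval c) := by
  simp only [R_eq_sum_range, sum_comp, mul_comp, C_comp, X_pow_comp, add_pow_char_pow, mul_add,
    Finset.sum_add_distrib, eval_finsetSum, eval_mul, eval_C, eval_pow, eval_X, map_sum, C_mul,
    C_pow]

variable [Fact (p ≠ 2)]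

theorem aeval_x_add (r : AddPoly p h) (c : K p) (g : (K p)[X]) :
    aeval (r.x + algebraMap (K p) r.FunctionField c) g = aeval r.x (g.comp (X + C c)) := by
  simp [aeval_comp]

/-- The pair `(σ, c, Q)` is such that `σ` maps `x` to `x + c` and `y` to `y + Q(x)`. -/
structure IsShift (r : AddPoly p h) (σ : r.Aut) (c : K p) (Q : (K p)[X]) : Prop where
  apply_x : σ r.x = r.x + algebraMap (K p) r.FunctionField c
  apply_y : σ r.y = r.y + aeval r.x Q

namespace IsShift

variable {r : AddPoly p h} {σ τ : r.Aut} {c d : K p} {Q S : (K p)[X]}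

theorem apply_aeval_x (hσ : r.IsShift σ c Q) (g : (K p)[X]) :
    σ (aeval r.x g) = aeval r.x (g.comp (X + C c)) := by
  rw [← aeval_x_add, ← hσ.apply_x, ← aeval_algHom_apply]

theorem mul (hσ : r.IsShift σ c Q) (hτ : r.IsShift τ d S) :
    r.IsShift (σ * τ) (c + d) (Q + S.comp (X + C c)) where
  apply_x := by
    rw [AlgEquiv.mul_apply, hτ.apply_x, map_add, hσ.apply_x, σ.commutes, map_add, add_assoc]
  apply_y := by
    rw [AlgEquiv.mul_apply, hτ.apply_y, map_add, hσ.apply_y, hσ.apply_aeval_x, map_add, add_assoc]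

theorem one : r.IsShift 1 0 0 := ⟨by simp, by simp⟩

theorem inv (hσ : r.IsShift σ c Q) : r.IsShift σ⁻¹ (-c) (-Q.comp (X - C c)) where
  apply_x := σ.injective (by
    rw [map_add, hσ.apply_x, σ.commutes, map_neg, add_neg_cancel_right]
    exact σ.apply_symm_apply _)
  apply_y := σ.injective (by
    rw [map_add, hσ.apply_y, hσ.apply_aeval_x, neg_comp, comp_assoc]
    simp only [sub_comp, X_comp, C_comp, add_sub_cancel_right, comp_X, map_neg,
      add_neg_cancel_right]
    exact σ.apply_symm_apply _)

/-- The equation of the curve, applied to `(x + c, y + Q(x))`. -/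
theorem equation (hσ : r.IsShift σ c Q) :
    Q ^ p - Q = C c * r.R + X * C (r.R.eval c) + C (c * r.R.eval c) := by
  apply r.aeval_x_injective
  have h1 := congrArg σ r.y_equation
  have h2 := r.y_equation
  rw [map_sub, map_pow, hσ.apply_y, map_mul, hσ.apply_x, hσ.apply_aeval_x, comp_R, add_pow_char,
    map_add, aeval_C] at h1
  simp only [map_sub, map_pow, map_add, map_mul, aeval_C, aeval_X]
  linear_combination h1 - h2

theorem mem_W (hσ : r.IsShift σ c Q) : c ∈ r.W := r.mem_W_of_sol hσ.equation

/-- The polynomial `Q` is additive up to its constant term. -/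
theorem comp_X_add_C (hσ : r.IsShift σ c Q) (d : K p) :
    Q.comp (X + C d) = Q + C ((r.sol c).eval d) := by
  obtain ⟨b, rfl⟩ := r.eq_sol_add_C hσ.equation
  simp only [sol, add_comp, sum_comp, mul_comp, C_comp, X_pow_comp, add_pow_char_pow, mul_add,
    Finset.sum_add_distrib, eval_finsetSum, eval_mul, eval_C, eval_pow, eval_X, map_sum, C_mul,
    C_pow]
  ring

/-- The multiples of `B_c(c)`, where `B_c = sol c`, add up to a binomial coefficient, as
`Q(X + i * c) = Q + i * B_c(c)`. -/
theorem pow (hσ : r.IsShift σ c Q) (m : ℕ) :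
    r.IsShift (σ ^ m) (m * c) (m * Q + C ((m.choose 2 : ℕ) * (r.sol c).eval c)) := by
  induction m with
  | zero => simpa using one
  | succ m ih =>
    have h1 := hσ.mul ih
    rw [← pow_succ'] at h1
    convert h1 using 1
    · push_cast
      ring
    · rw [add_comp, C_comp, mul_comp, hσ.comp_X_add_C, natCast_comp, Nat.choose_succ_succ' m 1,
        Nat.choose_one_right]
      push_cast
      simp only [C_mul, C_add, map_natCast]
      ring

theorem ext (hσ : r.IsShift σ c Q) (hτ : r.IsShift τ c Q) : σ = τ :=
  AlgEquiv.coe_toAlgHom_injective (r.algHom_ext' (hσ.apply_x.trans hτ.apply_x.symm)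
    (hσ.apply_y.trans hτ.apply_y.symm))

theorem pow_p (hσ : r.IsShift σ c Q) : σ ^ p = 1 := by
  have hp : p.Prime := Fact.out
  have h1 := hσ.pow p
  -- `p` is odd, so it divides `p.choose 2`
  have h2 : ((p.choose 2 : ℕ) : K p) = 0 := by
    rw [CharP.cast_eq_zero_iff (K p) p]
    exact hp.dvd_choose_self two_ne_zero (lt_of_le_of_ne hp.two_le (Fact.out : p ≠ 2).symm)
  rw [h2, CharP.cast_eq_zero, CharP.cast_eq_zero] at h1
  simp only [zero_mul, map_zero, add_zero] at h1
  exact h1.ext one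

theorem mul_comm_iff (hσ : r.IsShift σ c Q) (hτ : r.IsShift τ d S) :
    σ * τ = τ * σ ↔ (r.sol c).eval d = (r.sol d).eval c := by
  have h1 := hσ.mul hτ
  have h2 := hτ.mul hσ
  rw [hτ.comp_X_add_C] at h1
  rw [hσ.comp_X_add_C] at h2
  constructor
  · intro h3
    rw [h3] at h1
    have h4 := r.aeval_x_injective (add_left_cancel (h1.apply_y.symm.trans h2.apply_y))
    have h5 : C ((r.sol c).eval d) = C ((r.sol d).eval c) := by linear_combination -h4
    exact C_injective h5
  · intro h3
    rw [h3] at h2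
    refine h1.ext ?_
    convert h2 using 1 <;> ring

end IsShift

theorem isShift_ρ (r : AddPoly p h) : r.IsShift r.ρ 0 1 := ⟨by simp [ρ_x], by simp [ρ_y]⟩

theorem mem_zpowers_ρ_iff (r : AddPoly p h) {σ : r.Aut} :
    σ ∈ Subgroup.zpowers r.ρ ↔ ∃ Q, r.IsShift σ 0 Q := by
  have hpow : ∀ m : ℕ, r.IsShift (r.ρ ^ m) 0 (m : (K p)[X]) := fun m => by
    have h1 := r.isShift_ρ.pow m
    have h2 : (r.sol 0).eval 0 = 0 := by
      have := r.eval_sol_add 0 0 0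
      rw [add_zero] at this
      exact left_eq_add.1 this
    simpa [h2] using h1
  constructor
  · intro hσ
    have hfin : IsOfFinOrder r.ρ :=
      isOfFinOrder_iff_pow_eq_one.2 ⟨p, (Fact.out : p.Prime).pos, r.isShift_ρ.pow_p⟩
    obtain ⟨m, rfl⟩ := (Submonoid.mem_powers_iff _ _).1 (hfin.mem_powers_iff_mem_zpowers.2 hσ)
    exact ⟨_, hpow m⟩
  · rintro ⟨Q, hσ⟩
    have h0 : r.R.eval 0 = 0 := by
      have := r.eval_R_add 0 0
      rw [add_zero] at this
      exact left_eq_add.1 this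
    have h1 := hσ.equation
    rw [h0] at h1
    simp only [map_zero, zero_mul, mul_zero, add_zero] at h1
    obtain ⟨b, rfl⟩ := eq_C_of_pow_char_sub_eq_C (h1.trans C_0.symm)
    rw [← C_pow, ← C_sub, C_eq_zero, sub_eq_zero] at h1
    have h2 : b ∈ (⊥ : Subfield (K p)) := (Subfield.mem_bot_iff_pow_eq_self _ p).2 h1
    obtain ⟨e, rfl⟩ := (bot_le : (⊥ : Subfield (K p)) ≤ (algebraMap (ZMod p) (K p)).fieldRange) h2
    obtain ⟨m, rfl⟩ := ZMod.natCast_zmod_surjective e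
    have h3 : σ = r.ρ ^ m := hσ.ext (by simpa using hpow m)
    exact h3 ▸ Subgroup.npow_mem_zpowers r.ρ m

theorem orderOf_ρ (r : AddPoly p h) : orderOf r.ρ = p := by
  refine orderOf_eq_prime r.isShift_ρ.pow_p fun h1 => ?_
  have h2 := r.ρ_y
  rw [h1, AlgEquiv.one_apply] at h2
  exact one_ne_zero (left_eq_add.1 h2)

/-- Each `c` in `W` is realized: `Q = sol c + b` solves the equation for a suitable constant `b`. -/
theorem exists_isShift (r : AddPoly p h) {c : K p} (hc : c ∈ r.W) :
    ∃ (σ : r.Aut) (Q : (K p)[X]), r.IsShift σ c Q := by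
  have hp1 : 1 < p := (Fact.out : p.Prime).one_lt
  obtain ⟨b, hb⟩ : ∃ b : K p, b ^ p - b = c * r.R.eval c := by
    have hdeg : (X ^ p - (X + C (c * r.R.eval c)) : (K p)[X]).degree = p := by
      rw [degree_sub_eq_left_of_degree_lt, degree_X_pow]
      rw [degree_X_pow, degree_X_add_C]
      exact_mod_cast hp1
    obtain ⟨b, hb⟩ := IsAlgClosed.exists_root (X ^ p - (X + C (c * r.R.eval c)) : (K p)[X])
      (by rw [hdeg]; exact_mod_cast (by omega : p ≠ 0))
    refine ⟨b, ?_⟩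
    simp only [IsRoot.def, eval_sub, eval_pow, eval_X, eval_add, eval_C] at hb
    linear_combination hb
  obtain ⟨Q, hQ⟩ : ∃ Q : (K p)[X],
      Q ^ p - Q = C c * r.R + X * C (r.R.eval c) + C (c * r.R.eval c) := by
    refine ⟨r.sol c + C b, ?_⟩
    rw [add_pow_char, ← hb, C_sub, C_pow]
    linear_combination r.sol_pow_sub hc
  have hinj : Function.Injective
      (aeval (r.x + algebraMap (K p) r.FunctionField c) : (K p)[X] →ₐ[K p] r.FunctionField) := by
    intro f g hfg
    rw [aeval_x_add, aeval_x_add] at hfg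
    have h1 := congrArg (fun f : (K p)[X] => f.comp (X - C c)) (r.aeval_x_injective hfg)
    simpa [comp_assoc] using h1
  let i : RatFunc (K p) →ₐ[K p] r.FunctionField := IsFractionRing.liftAlgHom hinj
  have hi : ∀ g : (K p)[X], i (algebraMap (K p)[X] (RatFunc (K p)) g) =
      aeval (r.x + algebraMap (K p) r.FunctionField c) g := fun g =>
    IsFractionRing.lift_algebraMap hinj g
  have heq : eval₂ (i : RatFunc (K p) →+* r.FunctionField) (r.y + aeval r.x Q) r.equation = 0 := by
    have h1 := congrArg (aeval r.x) hQ
    have h2 := r.y_equation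
    simp only [map_sub, map_pow, map_add, map_mul, aeval_C, aeval_X] at h1
    rw [eval₂_equation, RingHom.coe_coe, hi, map_mul, aeval_X, aeval_x_add, comp_R, add_pow_char,
      map_add, aeval_C]
    linear_combination h1 + h2
  let φ : r.FunctionField →ₐ[K p] r.FunctionField := AdjoinRoot.liftAlgHom r.equation i _ heq
  have hφx : φ r.x = r.x + algebraMap (K p) r.FunctionField c := by
    have h1 : φ r.x = i RatFunc.X := AdjoinRoot.liftAlgHom_of ..
    rw [h1, ← RatFunc.algebraMap_X, hi, aeval_X]
  have hφy : φ r.y = r.y + aeval r.x Q := AdjoinRoot.liftAlgHom_root ..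
  have hx : r.x ∈ φ.range := by
    have := sub_mem (φ.mem_range_self r.x) (φ.range.algebraMap_mem c)
    rwa [hφx, add_sub_cancel_right] at this
  have hy : r.y ∈ φ.range := by
    have h1 : aeval r.x Q ∈ φ.range := by
      obtain ⟨u, hu⟩ := hx
      exact ⟨aeval u Q, by rw [← hu]; exact (aeval_algHom_apply φ u Q).symm⟩
    have := sub_mem (φ.mem_range_self r.y) h1
    rwa [hφy, add_sub_cancel_right] at this
  have hA : ∀ f : (K p)[X][X], aeval r.y f ∈ φ.range := fun f =>
    r.mem_of_mem_adjoin_y (S := φ.range.toSubring)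
      (by rw [Algebra.adjoin_singleton_eq_range_aeval]; exact ⟨f, rfl⟩)
      φ.range.algebraMap_mem hx hy
  have hsurj : Function.Surjective φ := fun z => by
    rcases eq_or_ne z 0 with rfl | hz
    · exact ⟨0, map_zero φ⟩
    · obtain ⟨f, g, -, -, -, -, rfl⟩ := r.exists_div_eq hz
      obtain ⟨u, hu⟩ := hA f
      obtain ⟨w, hw⟩ := hA g
      exact ⟨u / w, (map_div₀ φ u w).trans (congrArg₂ (· / ·) hu hw)⟩
  exact ⟨AlgEquiv.ofBijective φ ⟨φ.injective, hsurj⟩, Q, hφx, hφy⟩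

end AddPoly

end

/-! ### The Sylow subgroup -/

section

variable {p : ℕ} [Fact p.Prime] {h : ℕ}

namespace AddPoly

variable [Fact (p ≠ 2)]

/-- The group of the automorphisms `(x, y) ↦ (x + c, y + Q(x))`. -/
def shiftSubgroup (r : AddPoly p h) : Subgroup r.Aut where
  carrier := {σ | ∃ c Q, r.IsShift σ c Q}
  mul_mem' := fun ⟨_, _, h1⟩ ⟨_, _, h2⟩ => ⟨_, _, h1.mul h2⟩
  one_mem' := ⟨_, _, IsShift.one⟩
  inv_mem' := fun ⟨_, _, h1⟩ => ⟨_, _, h1.inv⟩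

/-- A shift preserves the set of places at which `x` is not regular, which is `{∞}`. -/
theorem shiftSubgroup_le_Aut₀ (r : AddPoly p h) (hh : 1 ≤ h) : r.shiftSubgroup ≤ r.Aut₀ := by
  rintro σ ⟨c, Q, hσ⟩
  simp only [Aut₀, Subgroup.mem_iInf]
  intro v hv
  have hmem : ∀ u, u ∈ σ • v ↔ σ⁻¹ u ∈ v := fun u =>
    ValuationSubring.mem_pointwise_smul_iff_inv_smul_mem
  refine r.isInfinite_unique hh (r.isInfinite_iff.2 ⟨fun e => ?_, fun h1 => ?_⟩) hv
  · rw [hmem, AlgEquiv.commutes]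
    exact hv.1.1 e
  · rw [hmem, hσ.inv.apply_x] at h1
    have h2 := sub_mem h1 (hv.1.1 (-c))
    rw [add_sub_cancel_right] at h2
    exact r.x_notMem_of_isInfinite hv h2

/-- The elements of `Aut₀` of `p`-power order are shifts, because they act on the leading terms of
`x` and `y` by `p`-power roots of unity in `k`, which are trivial. -/
theorem mem_shiftSubgroup_of_pow_eq_one (r : AddPoly p h) (hh : 1 ≤ h) {σ : r.Aut}
    (hσ : σ ∈ r.Aut₀) {m : ℕ} (hm : σ ^ p ^ m = 1) : σ ∈ r.shiftSubgroup := by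
  obtain ⟨a, b, hx⟩ := r.Aut₀_apply_x hh hσ
  obtain ⟨c, Q, hc, hy⟩ := r.Aut₀_apply_y hh hσ
  have hσx : ∀ g : (K p)[X], σ (aeval r.x g) = aeval r.x (g.comp (C a * X + C b)) := by
    intro g
    rw [aeval_comp, ← aeval_algHom_apply, hx]
    simp
  have hxn : ∀ n : ℕ, ∃ e : K p, (σ ^ n) r.x =
      algebraMap (K p) r.FunctionField (a ^ n) * r.x + algebraMap (K p) _ e := by
    intro n
    induction n with
    | zero => exact ⟨0, by simp⟩
    | succ n ih =>
      obtain ⟨e, he⟩ := ih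
      refine ⟨a ^ n * b + e, ?_⟩
      rw [pow_succ', AlgEquiv.mul_apply, he, map_add, map_mul, σ.commutes, σ.commutes, hx]
      simp only [map_mul, map_add, map_pow]
      ring
  have hyn : ∀ n : ℕ, ∃ S : (K p)[X], (σ ^ n) r.y =
      algebraMap (K p) r.FunctionField (c ^ n) * r.y + aeval r.x S := by
    intro n
    induction n with
    | zero => exact ⟨0, by simp⟩
    | succ n ih =>
      obtain ⟨S, hS⟩ := ih
      refine ⟨C (c ^ n) * Q + S.comp (C a * X + C b), ?_⟩
      rw [pow_succ', AlgEquiv.mul_apply, hS, map_add, map_mul, σ.commutes, hy, hσx]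
      simp only [map_mul, map_add, map_pow, aeval_C]
      ring
  have ha1 : a = 1 := by
    obtain ⟨e, he⟩ := hxn (p ^ m)
    rw [hm, AlgEquiv.one_apply] at he
    have h1 : (X : (K p)[X]) = C (a ^ p ^ m) * X + C e := r.aeval_x_injective (by simpa using he)
    have h2 := congrArg (coeff · 1) h1
    simp only [coeff_add, coeff_C_mul, coeff_X_one, mul_one, coeff_C, one_ne_zero, if_false,
      add_zero] at h2
    have h3 : (a - 1) ^ p ^ m = 0 := by rw [sub_pow_char_pow, ← h2, one_pow, sub_self]
    exact sub_eq_zero.1 (pow_eq_zero_iff (pow_pos (Fact.out : p.Prime).pos m).ne' |>.1 h3)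
  have hc1 : c = 1 := by
    obtain ⟨S, hS⟩ := hyn (p ^ m)
    have h1 : ∀ n : ℕ, c ^ p ^ n = c := fun n => by
      induction n with
      | zero => simp
      | succ n ih => rw [pow_succ, pow_mul, ih, hc]
    rw [hm, AlgEquiv.one_apply, h1] at hS
    have h2 := r.eq_zero_of_mul_y_eq_aeval_x hh (c := 1 - c) (g := S) (by
      rw [map_sub, map_one]
      linear_combination hS)
    exact (sub_eq_zero.1 h2).symm
  exact ⟨b, Q, by simpa [ha1] using hx, by simpa [hc1] using hy⟩

theorem isPGroup_shiftSubgroup (r : AddPoly p h) : IsPGroup p r.shiftSubgroup := by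
  rintro ⟨σ, c, Q, hσ⟩
  exact ⟨1, Subtype.ext (by simpa using hσ.pow_p)⟩

theorem coe_sylow_eq (r : AddPoly p h) (hh : 1 ≤ h) (P : Sylow p r.Aut₀) :
    (P : Subgroup r.Aut₀) = r.shiftSubgroup.subgroupOf r.Aut₀ := by
  refine (P.is_maximal' ?_ fun σ hσ => ?_).symm
  · exact r.isPGroup_shiftSubgroup.comap_of_injective r.Aut₀.subtype r.Aut₀.subtype_injective
  · obtain ⟨m, hm⟩ := P.isPGroup' ⟨σ, hσ⟩
    refine r.mem_shiftSubgroup_of_pow_eq_one hh σ.2 (m := m) ?_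
    exact congrArg (fun τ : P => ((τ : r.Aut₀) : r.Aut)) hm

section Group

variable {G : Type*} [Group G]

/-- The homomorphism that maps a shift `(x, y) ↦ (x + c, y + Q(x))` to `c`. -/
theorem exists_shiftHom (r : AddPoly p h) {ι : G →* r.Aut} (hι : ι.range = r.shiftSubgroup) :
    ∃ f : G →* Multiplicative r.W, Function.Surjective f ∧ ∀ g, ∃ Q,
      r.IsShift (ι g) ((f g).toAdd : r.W) Q := by
  have h1 : ∀ g, ∃ c : r.W, ∃ Q, r.IsShift (ι g) c Q := fun g => by
    obtain ⟨c, Q, hσ⟩ : ι g ∈ r.shiftSubgroup := hι ▸ ⟨g, rfl⟩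
    exact ⟨⟨c, hσ.mem_W⟩, Q, hσ⟩
  choose f hf using h1
  have huniq : ∀ {σ : r.Aut} {c d : r.W}, (∃ Q, r.IsShift σ c Q) → (∃ Q, r.IsShift σ d Q) →
      c = d := by
    rintro σ c d ⟨Q, hQ⟩ ⟨S, hS⟩
    exact Subtype.ext ((algebraMap (K p) r.FunctionField).injective
      (add_left_cancel (hQ.apply_x.symm.trans hS.apply_x)))
  refine ⟨MonoidHom.mk' (fun g => Multiplicative.ofAdd (f g)) fun g g' => ?_, fun c => ?_, hf⟩
  · obtain ⟨Q, hQ⟩ := hf g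
    obtain ⟨S, hS⟩ := hf g'
    refine congrArg Multiplicative.ofAdd (huniq (hf (g * g'))
      ⟨Q + S.comp (X + C (f g : K p)), ?_⟩)
    rw [map_mul]
    exact hQ.mul hS
  · obtain ⟨σ, Q, hσ⟩ := r.exists_isShift c.toAdd.2
    obtain ⟨g, rfl⟩ : σ ∈ ι.range := hι ▸ ⟨_, _, hσ⟩
    exact ⟨g, congrArg Multiplicative.ofAdd (huniq (hf g) ⟨Q, hσ⟩)⟩

variable {r : AddPoly p h} {ι : G →* r.Aut} {f : G →* Multiplicative r.W}

/-- A shift `(x, y) ↦ (x, y + Q(x))` is a power of `ρ`. -/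
theorem ker_shiftHom_eq
    (hf : ∀ g, ∃ Q, r.IsShift (ι g) ((f g).toAdd : r.W) Q) :
    f.ker = (Subgroup.zpowers r.ρ).comap ι := by
  ext g
  rw [MonoidHom.mem_ker, Subgroup.mem_comap, mem_zpowers_ρ_iff]
  obtain ⟨Q, hQ⟩ := hf g
  constructor
  · intro h1
    rw [h1] at hQ
    exact ⟨Q, hQ⟩
  · rintro ⟨S, hS⟩
    have h1 := (algebraMap (K p) r.FunctionField).injective
      (add_left_cancel (hQ.apply_x.symm.trans hS.apply_x))
    exact Multiplicative.toAdd.injective (Subtype.ext h1)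

theorem center_eq_ker_shiftHom (hh : 1 ≤ h) (hι' : Function.Injective ι)
    (hsurj : Function.Surjective f)
    (hf : ∀ g, ∃ Q, r.IsShift (ι g) ((f g).toAdd : r.W) Q) :
    Subgroup.center G = f.ker := by
  ext g
  obtain ⟨Q, hQ⟩ := hf g
  have hcomm : g ∈ Subgroup.center G ↔ ∀ g' : G,
      (r.sol ((f g).toAdd : r.W)).eval (((f g').toAdd : r.W) : K p) =
        (r.sol ((f g').toAdd : r.W)).eval (((f g).toAdd : r.W) : K p) := by
    rw [Subgroup.mem_center_iff]
    refine forall_congr' fun g' => ?_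
    obtain ⟨S, hS⟩ := hf g'
    rw [← hQ.mul_comm_iff hS, ← map_mul, ← map_mul, hι'.eq_iff, eq_comm]
  rw [hcomm, MonoidHom.mem_ker]
  constructor
  · intro h1
    have h2 : (((f g).toAdd : r.W) : K p) = 0 := by
      refine r.eq_zero_of_eval_sol_comm hh fun d hd => ?_
      obtain ⟨g', hg'⟩ := hsurj (Multiplicative.ofAdd ⟨d, hd⟩)
      simpa [hg'] using h1 g'
    exact Multiplicative.toAdd.injective (Subtype.ext h2)
  · intro h1 g'
    obtain ⟨S, hS⟩ := hf g'
    simpa [h1] using (IsShift.one.mul_comm_iff hS).1 (by simp)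

/-- The properties of `shiftSubgroup`, stated for a group `G` with an injective homomorphism onto
it, so that they apply to the Sylow subgroups of `Aut₀` without transport along an isomorphism. -/
theorem isExtraspecial_of_range_eq (hh : 1 ≤ h) (hι' : Function.Injective ι)
    (hι : ι.range = r.shiftSubgroup) :
    IsExtraspecial p G ∧ Monoid.exponent G = p ∧
      (Subgroup.center G).map ι = Subgroup.zpowers r.ρ ∧
      ∃ e : (G ⧸ Subgroup.center G) ≃* Multiplicative r.W, ∀ g : G,
        ι g r.x = r.x + algebraMap (K p) r.FunctionField
          ((Multiplicative.toAdd (e (g : G ⧸ Subgroup.center G)) : r.W) : K p) := by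
  have hp : p.Prime := Fact.out
  obtain ⟨f, hsurj, hf⟩ := r.exists_shiftHom hι
  have hker := ker_shiftHom_eq hf
  have hcen := center_eq_ker_shiftHom hh hι' hsurj hf
  have hpow : ∀ g : G, g ^ p = 1 := fun g => by
    obtain ⟨Q, hQ⟩ := hf g
    exact hι' (by rw [map_pow, hQ.pow_p, map_one])
  have hmap : (Subgroup.center G).map ι = Subgroup.zpowers r.ρ := by
    rw [hcen, hker, Subgroup.map_comap_eq_self]
    rw [hι, Subgroup.zpowers_le]
    exact ⟨_, _, r.isShift_ρ⟩
  have hcard : Nat.card (Subgroup.center G) = p := by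
    rw [← Subgroup.card_map_of_injective hι', hmap, Nat.card_zpowers, orderOf_ρ]
  let e : (G ⧸ Subgroup.center G) ≃* Multiplicative r.W :=
    (QuotientGroup.quotientMulEquivOfEq hcen).trans
      (QuotientGroup.quotientKerEquivOfSurjective f hsurj)
  have he : ∀ g : G, e g = f g := fun g => rfl
  have hW : Finite r.W := r.finite_W hh
  have hquot : Finite (G ⧸ Subgroup.center G) := Finite.of_equiv (Multiplicative r.W) e.symm
  have hcenfin : Finite (Subgroup.center G) := Nat.finite_of_card_ne_zero (hcard ▸ hp.ne_zero)
  have hnontriv : ∃ g : G, g ∉ Subgroup.center G := by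
    -- otherwise `W = 0`, so `X` vanishes on `W`, although `1 < p ^ (2 * h)`
    by_contra! hall
    refine X_ne_zero (r.eq_zero_of_eval_W_eq_zero hh (H := X) ?_ fun c hc => ?_)
    · rw [natDegree_X]
      exact Nat.one_lt_pow (by omega) hp.one_lt
    · obtain ⟨g, hg⟩ := hsurj (Multiplicative.ofAdd ⟨c, hc⟩)
      have h1 := hall g
      rw [hcen, MonoidHom.mem_ker, hg] at h1
      rw [eval_X]
      exact congrArg Subtype.val (Multiplicative.ofAdd.injective h1)
  have hne : ∃ g : G, g ≠ 1 := by
    obtain ⟨g, hg⟩ := hnontriv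
    exact ⟨g, fun h1 => hg (h1 ▸ one_mem _)⟩
  refine ⟨⟨?_, fun g => ⟨1, by rw [pow_one, hpow]⟩, ?_, hcard, fun a b => ?_, fun a => ?_⟩, ?_,
    hmap, e, fun g => ?_⟩
  · exact Finite.of_equiv _ (Subgroup.groupEquivQuotientProdSubgroup (s := Subgroup.center G)).symm
  · obtain ⟨g, hg⟩ := hnontriv
    rw [Subgroup.mem_center_iff] at hg
    push Not at hg
    obtain ⟨g', hg'⟩ := hg
    exact ⟨g', g, hg'⟩
  · exact e.injective (by rw [map_mul, map_mul, mul_comm])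
  · obtain ⟨g, rfl⟩ := QuotientGroup.mk_surjective a
    rw [← QuotientGroup.mk_pow, hpow, QuotientGroup.mk_one]
  · obtain ⟨g, hg⟩ := hne
    have h1 : Monoid.exponent G ∣ p := Monoid.exponent_dvd_of_forall_pow_eq_one hpow
    refine ((Nat.dvd_prime hp).1 h1).resolve_left fun h2 => hg ?_
    have := Monoid.pow_exponent_eq_one g
    rwa [h2, pow_one] at this
  · rw [he]
    obtain ⟨Q, hQ⟩ := hf g
    exact hQ.apply_x

end Group

end AddPoly

end

end ArtinSchreier

end

theorem mainTheorem5 (p : ℕ) [Fact p.Prime] [Fact (p ≠ 2)] (h : ℕ) (hh : 1 ≤ h)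
    (r : ArtinSchreier.AddPoly p h) :
    (∃! v : ValuationSubring r.FunctionField, r.IsInfinite v) ∧
    Nat.card (Sylow p r.Aut₀) = 1 ∧
    ∀ P : Sylow p r.Aut₀,
      ArtinSchreier.IsExtraspecial p P ∧
      Monoid.exponent P = p ∧
      ((Subgroup.center P).map (P : Subgroup r.Aut₀).subtype).map r.Aut₀.subtype =
        Subgroup.zpowers r.ρ ∧
      ∃ e : (P ⧸ Subgroup.center P) ≃* Multiplicative r.W, ∀ σ : P,
        ((σ : r.Aut₀) : r.Aut) r.x = r.x + algebraMap (ArtinSchreier.K p) r.FunctionField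
          ((Multiplicative.toAdd (e (σ : P ⧸ Subgroup.center P)) : r.W) :
            ArtinSchreier.K p) := by
  refine ⟨r.existsUnique_isInfinite hh, ?_, fun P => ?_⟩
  · rw [Nat.card_eq_one_iff_unique]
    exact ⟨⟨fun P Q => Sylow.ext ((r.coe_sylow_eq hh P).trans (r.coe_sylow_eq hh Q).symm)⟩,
      inferInstance⟩
  · rw [Subgroup.map_map]
    refine ArtinSchreier.AddPoly.isExtraspecial_of_range_eq hh
      (ι := r.Aut₀.subtype.comp (P : Subgroup r.Aut₀).subtype)
      (r.Aut₀.subtype_injective.comp (P : Subgroup r.Aut₀).subtype_injective) ?_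
    rw [MonoidHom.range_comp, Subgroup.range_subtype, r.coe_sylow_eq hh P,
      Subgroup.map_subgroupOf_eq_of_le (r.shiftSubgroup_le_Aut₀ hh)]
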